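/- Let $G$ be a simple, simply connected algebraic group over $\mathbb C$ with maximal torus $T$; let $T^*$ be the character lattice (the weight lattice), $\Phi\subset T^*$ the roots, $\alpha_1,\dots,\alpha_n$ the simple roots, $\theta$ the highest root, $W$ the Weyl group, $Q^\vee$ the coroot lattice, and $W_{\mathrm a}=Q^\vee\rtimes W$ the affine Weyl group, with translations $t_\lambda$ ($\lambda\in Q^\vee$) and $s_0=t_{\theta^\vee}s_\theta$. Let $F$ be a one-dimensional commutative formal group law over a domain $R$ of characteristic $0$, and let $$S=R[[x_\mu\mid\mu\in T^*]]/\mathcal J_F$$ be the formal group algebra, where $R[[x_\mu\mid \mu\in T^*]]$ is the completion of the polynomial ring $R[x_\mu\mid\mu\in T^*]$ at its augmentation ideal and $\mathcal J_F$ is the closure of the ideal generated by $x_0$ and all $x_{\mu+\nu}-F(x_\mu,x_\nu)$. If $F(x,y)=x+y-cxy$ with $c\in R$ is a connective formal group law, one may instead take for $S$ the polynomial version $R[x_\mu\mid\mu\in T^*]/(x_0,\ x_{\mu+\nu}-F(x_\mu,x_\nu))$; the theorem holds for both choices. The group $W_{\mathrm a}$ acts on $S$ through $W_{\mathrm a}\to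 W$, with $w(x_\mu)=x_{w(\mu)}$ (so translations act trivially). Put $\mathcal Q=S[\tfrac1{x_\alpha},\ \alpha\in\Phi]$. Let $\mathcal Q_{W_{\mathrm a}}=\mathcal Q\rtimes R[W_{\mathrm a}]$ be the twisted group algebra with left $\mathcal Q$-basis $\eta_w$ ($w\in W_{\mathrm a}$) and product $c\eta_w\, c'\eta_{w'}=c\,w(c')\eta_{ww'}$, and let $\mathcal Q_{Q^\vee}=\mathcal Q\rtimes R[Q^\vee]$, with basis $\eta_{t_\lambda}$. Let $k:\mathcal Q_{Q^\vee}\to\mathcal Q_{W_{\mathrm a}}$ be the ring embedding $p\,\eta_{t_\lambda}\mapsto p\,\eta_{t_\lambda}$, and let $\mathrm{pr}:\mathcal Q_{W_{\mathrm a}}\to\mathcal Q_{Q^\vee}$ be the $\mathcal Q$-linear map $\eta_{t_\lambda w}\mapsto\eta_{t_\lambda}$ ($\lambda\in Q^\vee$, $w\in W$). The small-torus formal affine Demazure algebra $\mathbf D_{W_{\mathrm a}}$ is the subalgebra of $\mathcal Q_{W_{\mathrm a}}$ generated by $S$, the elements $X_i=\frac1{x_{\alpha_i}}(1-\eta_{s_i})$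 for $1\le i\le n$, and $X_0=\frac1{x_{-\theta}}(1-\eta_{s_0})$. Put $\mathbf D_{W_{\mathrm a}/W}=\mathrm{pr}(\mathbf D_{W_{\mathrm a}})$, and let $C_{\mathbf D_{W_{\mathrm a}}}(S)$ be the centralizer of $S$ in $\mathbf D_{W_{\mathrm a}}$. Then $$C_{\mathbf D_{W_{\mathrm a}}}(S)=k(\mathcal Q_{Q^\vee})\cap\mathbf D_{W_{\mathrm a}}=k(\mathbf D_{W_{\mathrm a}/W}).$$ In other words, the Peterson subalgebra $\mathbf D_{Q^\vee}:=k(\mathbf D_{W_{\mathrm a}/W})$ is the centralizer of $S$ in $\mathbf D_{W_{\mathrm a}}$. -/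

import Mathlib

noncomputable section

namespace Peterson

open SkewMonoidAlgebra

/-! ## Formal group algebras of a lattice -/

section AdicMap

variable {A B C : Type*} [CommRing A] [CommRing B] [CommRing C]

theorem adicMap_compat {I : Ideal A} {J : Ideal B} (f : A →+* B) (h : I ≤ J.comap f)
    {m n : ℕ} (hle : m ≤ n) :
    (Ideal.Quotient.factorPow J hle).comp ((Ideal.quotientMap (J ^ n) f
      ((Ideal.pow_right_mono h n).trans (Ideal.le_comap_pow f n))).comp
        (AdicCompletion.evalₐ I n).toRingHom) =
    (Ideal.quotientMap (J ^ m) f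
      ((Ideal.pow_right_mono h m).trans (Ideal.le_comap_pow f m))).comp
        (AdicCompletion.evalₐ I m).toRingHom := by
  ext x
  obtain ⟨x, rfl⟩ := AdicCompletion.mk_surjective I A x
  have hx := AdicCompletion.Ideal.mk_eq_mk I hle x
  have := congrArg (Ideal.quotientMap (J ^ m) f
    ((Ideal.pow_right_mono h m).trans (Ideal.le_comap_pow f m))) hx
  simp only [RingHom.comp_apply, AlgHom.toRingHom_eq_coe, RingHom.coe_coe,
    AdicCompletion.evalₐ_mk, Ideal.quotientMap_mk] at this ⊢
  exact this

/-- The ring homomorphism of adic completions induced by a ring homomorphism `f` with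
`f(I) ⊆ J`. -/
def adicMap {I : Ideal A} {J : Ideal B} (f : A →+* B) (h : I ≤ J.comap f) :
    AdicCompletion I A →+* AdicCompletion J B :=
  AdicCompletion.liftRingHom J
    (fun n => (Ideal.quotientMap (J ^ n) f
      ((Ideal.pow_right_mono h n).trans (Ideal.le_comap_pow f n))).comp
        (AdicCompletion.evalₐ I n).toRingHom)
    (adicMap_compat f h)

theorem evalₐ_adicMap {I : Ideal A} {J : Ideal B} (f : A →+* B) (h : I ≤ J.comap f) (n : ℕ)
    (x : AdicCompletion I A) :
    AdicCompletion.evalₐ J n (adicMap f h x) = Ideal.quotientMap (J ^ n) f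
      ((Ideal.pow_right_mono h n).trans (Ideal.le_comap_pow f n))
        (AdicCompletion.evalₐ I n x) :=
  AdicCompletion.evalₐ_liftRingHom J _ (adicMap_compat f h) n x

theorem adicMap_of {I : Ideal A} {J : Ideal B} (f : A →+* B) (h : I ≤ J.comap f) (a : A) :
    adicMap f h (AdicCompletion.of I A a) = AdicCompletion.of J B (f a) := by
  apply AdicCompletion.ext_evalₐ
  intro n
  simp [evalₐ_adicMap]

theorem adicMap_id {I : Ideal A} (h : I ≤ I.comap (RingHom.id A)) (x : AdicCompletion I A) :
    adicMap (RingHom.id A) h x = x := by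
  apply AdicCompletion.ext_evalₐ
  intro n
  rw [evalₐ_adicMap]
  obtain ⟨y, hy⟩ := Ideal.Quotient.mk_surjective (AdicCompletion.evalₐ I n x)
  rw [← hy]
  simp

theorem adicMap_adicMap {I : Ideal A} {J : Ideal B} {K : Ideal C} (f : A →+* B) (g : B →+* C)
    (hf : I ≤ J.comap f) (hg : J ≤ K.comap g) (hgf : I ≤ K.comap (g.comp f))
    (x : AdicCompletion I A) :
    adicMap g hg (adicMap f hf x) = adicMap (g.comp f) hgf x := by
  apply AdicCompletion.ext_evalₐ
  intro n
  rw [evalₐ_adicMap, evalₐ_adicMap, evalₐ_adicMap]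
  obtain ⟨y, hy⟩ := Ideal.Quotient.mk_surjective (AdicCompletion.evalₐ I n x)
  rw [← hy]
  simp

theorem adicMap_congr {I : Ideal A} {J : Ideal B} {f g : A →+* B} (e : f = g)
    (hf : I ≤ J.comap f) (hg : I ≤ J.comap g) (x : AdicCompletion I A) :
    adicMap f hf x = adicMap g hg x := by
  subst e; rfl

end AdicMap

section FormalGroupAlgebra

variable {R : Type*} [CommRing R]

theorem idealOfVars_le_comap_rename {σ τ : Type*} (g : σ → τ) :
    MvPolynomial.idealOfVars σ R ≤
      (MvPolynomial.idealOfVars τ R).comap (MvPolynomial.rename g : _ →ₐ[R] _).toRingHom := by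
  rw [MvPolynomial.idealOfVars, Ideal.span_le]
  rintro _ ⟨s, rfl⟩
  simp only [SetLike.mem_coe, Ideal.mem_comap, AlgHom.toRingHom_eq_coe, RingHom.coe_coe,
    MvPolynomial.rename_X]
  exact Ideal.subset_span ⟨g s, rfl⟩

/-- `R[[x_μ | μ ∈ M]]`: the completion of the polynomial ring `R[x_μ | μ ∈ M]` at its
augmentation ideal. -/
abbrev PowerSeriesRing (R M : Type*) [CommRing R] : Type _ :=
  AdicCompletion (MvPolynomial.idealOfVars M R) (MvPolynomial M R)

/-- The homomorphism of completed polynomial rings that renames the variables. -/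
def renameVars {σ τ : Type*} (g : σ → τ) : PowerSeriesRing R σ →+* PowerSeriesRing R τ :=
  adicMap (MvPolynomial.rename g : _ →ₐ[R] _).toRingHom (idealOfVars_le_comap_rename g)

theorem renameVars_of {σ τ : Type*} (g : σ → τ) (p : MvPolynomial σ R) :
    renameVars g (AdicCompletion.of _ _ p : PowerSeriesRing R σ) =
      AdicCompletion.of _ _ (MvPolynomial.rename g p) :=
  adicMap_of _ _ p

theorem renameVars_id {σ : Type*} (x : PowerSeriesRing R σ) : renameVars id x = x := by
  have e : (MvPolynomial.rename (id : σ → σ) : _ →ₐ[R] _).toRingHom = RingHom.id _ := by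
    rw [MvPolynomial.rename_id]; rfl
  rw [renameVars, adicMap_congr e _ (by rw [← e]; exact idealOfVars_le_comap_rename id)]
  exact adicMap_id _ x

theorem renameVars_renameVars {σ τ υ : Type*} (g : σ → τ) (h : τ → υ)
    (x : PowerSeriesRing R σ) : renameVars h (renameVars g x) = renameVars (h ∘ g) x := by
  have e : (MvPolynomial.rename h : _ →ₐ[R] _).toRingHom.comp
      (MvPolynomial.rename g : _ →ₐ[R] _).toRingHom =
        (MvPolynomial.rename (h ∘ g) : _ →ₐ[R] _).toRingHom := by
    ext x <;> simp
  rw [renameVars, renameVars, adicMap_adicMap _ _ _ _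
    (by rw [e]; exact idealOfVars_le_comap_rename _), renameVars]
  exact adicMap_congr e _ _ x

theorem ker_evalₐ_le_comap_renameVars {σ τ : Type*} (g : σ → τ) (n : ℕ) :
    RingHom.ker (AdicCompletion.evalₐ (MvPolynomial.idealOfVars σ R) n) ≤
      (RingHom.ker (AdicCompletion.evalₐ (MvPolynomial.idealOfVars τ R) n)).comap
        (renameVars g) := by
  intro x hx
  rw [RingHom.mem_ker] at hx
  rw [Ideal.mem_comap, RingHom.mem_ker, renameVars, evalₐ_adicMap, hx, map_zero]

/-- `F(x_s, x_t)` in the completed polynomial ring, for a power series `F` in two variables. -/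
def substVars {σ : Type*} (F : MvPowerSeries (Fin 2) R) (s t : σ) : PowerSeriesRing R σ :=
  renameVars ![s, t] (MvPowerSeries.toAdicCompletion (Fin 2) R F)

theorem renameVars_substVars {σ τ : Type*} (g : σ → τ) (F : MvPowerSeries (Fin 2) R) (s t : σ) :
    renameVars g (substVars F s t) = substVars F (g s) (g t) := by
  rw [substVars, renameVars_renameVars, substVars]
  congr 2
  funext i
  fin_cases i <;> rfl

/-- The closure of an ideal of `R[[x_μ | μ ∈ M]]` in the inverse limit topology. -/
def closureIdeal {M : Type*} (J : Ideal (PowerSeriesRing R M)) : Ideal (PowerSeriesRing R M) :=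
  ⨅ n : ℕ, J ⊔ RingHom.ker (AdicCompletion.evalₐ (MvPolynomial.idealOfVars M R) n)

variable {M : Type*} [AddCommGroup M]

/-- The ideal of `R[[x_μ | μ ∈ M]]` generated by `x_0` and all
`x_{μ+ν} - F(x_μ, x_ν)`. -/
def formalRelations (F : FormalGroup R) (M : Type*) [AddCommGroup M] :
    Ideal (PowerSeriesRing R M) :=
  Ideal.span ({AdicCompletion.of _ _ (MvPolynomial.X 0)} ∪
    Set.range fun p : M × M =>
      AdicCompletion.of _ _ (MvPolynomial.X (p.1 + p.2)) - substVars F.toPowerSeries p.1 p.2)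

/-- The formal group algebra `R[[x_μ | μ ∈ M]] / 𝒥_F`, where `𝒥_F` is the closure of the ideal
generated by `x_0` and all `x_{μ+ν} - F(x_μ, x_ν)`. -/
abbrev FormalGroupAlgebra (F : FormalGroup R) (M : Type*) [AddCommGroup M] : Type _ :=
  PowerSeriesRing R M ⧸ closureIdeal (formalRelations F M)

theorem formalRelations_le_comap (F : FormalGroup R) (g : M →+ M) :
    formalRelations F M ≤ (formalRelations F M).comap (renameVars g) := by
  rw [formalRelations, Ideal.span_le]
  rintro _ (rfl | ⟨⟨μ, ν⟩, rfl⟩)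
  · rw [SetLike.mem_coe, Ideal.mem_comap, renameVars_of, MvPolynomial.rename_X, map_zero]
    exact Ideal.subset_span (Or.inl rfl)
  · rw [SetLike.mem_coe, Ideal.mem_comap, map_sub, renameVars_of, MvPolynomial.rename_X,
      renameVars_substVars, map_add]
    exact Ideal.subset_span (Or.inr ⟨(g μ, g ν), rfl⟩)

theorem closureIdeal_le_comap (F : FormalGroup R) (g : M →+ M) :
    closureIdeal (formalRelations F M) ≤
      (closureIdeal (formalRelations F M)).comap (renameVars g) := by
  intro x hx
  rw [Ideal.mem_comap]
  simp only [closureIdeal, Submodule.mem_iInf] at hx ⊢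
  intro n
  obtain ⟨a, ha, b, hb, rfl⟩ := Submodule.mem_sup.1 (hx n)
  rw [map_add]
  exact Submodule.add_mem_sup (formalRelations_le_comap F g ha)
    (ker_evalₐ_le_comap_renameVars g n hb)

/-- The endomorphism `x_μ ↦ x_{g(μ)}` of the formal group algebra. -/
def FormalGroupAlgebra.map (F : FormalGroup R) (g : M →+ M) :
    FormalGroupAlgebra F M →+* FormalGroupAlgebra F M :=
  Ideal.quotientMap _ (renameVars g) (closureIdeal_le_comap F g)

/-- The ideal of `R[x_μ | μ ∈ M]` generated by `x_0` and all
`x_{μ+ν} - (x_μ + x_ν - c x_μ x_ν)`. -/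
def connectiveRelations (c : R) (M : Type*) [AddCommGroup M] : Ideal (MvPolynomial M R) :=
  Ideal.span ({MvPolynomial.X 0} ∪
    Set.range fun p : M × M =>
      MvPolynomial.X (p.1 + p.2) - (MvPolynomial.X p.1 + MvPolynomial.X p.2 -
        MvPolynomial.C c * MvPolynomial.X p.1 * MvPolynomial.X p.2))

/-- The polynomial version of the formal group algebra for the connective formal group law
`F_c(x, y) = x + y - cxy`. -/
abbrev ConnectiveAlgebra (c : R) (M : Type*) [AddCommGroup M] : Type _ :=
  MvPolynomial M R ⧸ connectiveRelations c M

theorem connectiveRelations_le_comap (c : R) (g : M →+ M) :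
    connectiveRelations c M ≤ (connectiveRelations c M).comap
      (MvPolynomial.rename g : _ →ₐ[R] _).toRingHom := by
  rw [connectiveRelations, Ideal.span_le]
  rintro _ (rfl | ⟨⟨μ, ν⟩, rfl⟩)
  · simp only [SetLike.mem_coe, Ideal.mem_comap, AlgHom.toRingHom_eq_coe, RingHom.coe_coe,
      MvPolynomial.rename_X, map_zero]
    exact Ideal.subset_span (Or.inl rfl)
  · simp only [SetLike.mem_coe, Ideal.mem_comap, AlgHom.toRingHom_eq_coe, RingHom.coe_coe,
      MvPolynomial.rename_X, map_sub, map_add, map_mul, MvPolynomial.rename_C]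
    exact Ideal.subset_span (Or.inr ⟨(g μ, g ν), rfl⟩)

/-- The endomorphism `x_μ ↦ x_{g(μ)}` of the polynomial version. -/
def ConnectiveAlgebra.map (c : R) (g : M →+ M) :
    ConnectiveAlgebra c M →+* ConnectiveAlgebra c M :=
  Ideal.quotientMap _ (MvPolynomial.rename g : _ →ₐ[R] _).toRingHom
    (connectiveRelations_le_comap c g)

end FormalGroupAlgebra

/-! ## Root data and the affine Weyl group -/

section RootData

variable {ι M N : Type*} [AddCommGroup M] [AddCommGroup N]

/-- The root datum is irreducible: there is a root, and the roots are not the disjoint union of two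
non-empty, mutually orthogonal subsets. -/
def IsIrreducibleRootDatum (P : RootPairing ι ℤ M N) : Prop :=
  Nonempty ι ∧ ∀ s : Set ι, s.Nonempty → sᶜ.Nonempty → ∃ i ∈ s, ∃ j ∈ sᶜ, P.pairing i j ≠ 0

/-- The root datum is simply connected: the cocharacter lattice `N` is the coroot lattice `Q^∨`
(so the character lattice `M` is the weight lattice). -/
def IsSimplyConnected (P : RootPairing ι ℤ M N) : Prop :=
  P.corootSpan ℤ = ⊤

/-- `θ` is the highest root with respect to the base `b`: its difference with any root is a sum of
simple roots. -/
def IsHighestRoot {P : RootPairing ι ℤ M N} (b : P.Base) (θ : ι) : Prop :=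
  ∀ i, P.root θ - P.root i ∈ AddSubmonoid.closure (P.root '' b.support)

/-- The (left) action of the Weyl group on the lattice `N`, contragredient to the action
on `M`, written on the multiplicative copy of `N` (whose elements are the translations `t_λ`). -/
def weylActionOnTranslations (P : RootPairing ι ℤ M N) :
    P.weylGroup →* MulAut (Multiplicative N) where
  toFun w :=
    { toFun := fun l => .ofAdd (MulOpposite.op ((w : P.Aut)⁻¹) • l.toAdd)
      invFun := fun l => .ofAdd (MulOpposite.op (w : P.Aut) • l.toAdd)
      left_inv := fun l => by simp [← mul_smul]
      right_inv := fun l => by simp [← mul_smul]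
      map_mul' := fun l m => by simp [smul_add] }
  map_one' := by ext l; simp
  map_mul' v w := by
    ext l
    change MulOpposite.op (((v * w : P.weylGroup) : P.Aut)⁻¹) • l.toAdd =
      MulOpposite.op ((v : P.Aut)⁻¹) • MulOpposite.op ((w : P.Aut)⁻¹) • l.toAdd
    rw [Subgroup.coe_mul, mul_inv_rev, MulOpposite.op_mul, mul_smul]

/-- The affine Weyl group `W_a = Q^∨ ⋊ W`; the pair `⟨λ, w⟩` is `t_λ w`. -/
abbrev AffineWeylGroup (P : RootPairing ι ℤ M N) : Type _ :=
  Multiplicative N ⋊[weylActionOnTranslations P] P.weylGroup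

/-- The reflection `s_i` in the `i`-th (finite) root, as an element of `W_a`. -/
def finiteReflection (P : RootPairing ι ℤ M N) (i : ι) : AffineWeylGroup P :=
  ⟨1, RootPairing.weylGroup.ofIdx P i⟩

/-- The reflection `s_0 = t_{θ^∨} s_θ` in the affine root `-θ + δ`. -/
def affineReflection (P : RootPairing ι ℤ M N) (θ : ι) : AffineWeylGroup P :=
  ⟨.ofAdd (P.coroot θ), RootPairing.weylGroup.ofIdx P θ⟩

/-- A commutative ring `S` with an action of `W` and a `W`-equivariant family of elements
`x_μ`, `μ ∈ M`; the cases of interest are the two constructions that follow. -/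
structure EquivariantRing (P : RootPairing ι ℤ M N) (S : Type*) [CommRing S] where
  /-- the action of the Weyl group -/
  act : P.weylGroup →* (S →+* S)
  /-- the elements `x_μ` -/
  x : M → S
  act_x : ∀ w μ, act w (x μ) = x (w • μ)

/-- The formal group algebra of the lattice `M` with `w(x_μ) = x_{w(μ)}`. -/
def formalRing {R : Type*} [CommRing R] (P : RootPairing ι ℤ M N) (F : FormalGroup R) :
    EquivariantRing P (FormalGroupAlgebra F M) where
  act :=
    { toFun := fun w => FormalGroupAlgebra.map F (DistribSMul.toAddMonoidHom M w)
      map_one' := by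
        refine RingHom.ext fun y => ?_
        obtain ⟨y, rfl⟩ := Ideal.Quotient.mk_surjective y
        have : ⇑(DistribSMul.toAddMonoidHom M (1 : P.weylGroup)) = id := by
          funext m; simp
        simp only [FormalGroupAlgebra.map, Ideal.quotientMap_mk, this, renameVars_id,
          RingHom.one_def, RingHom.id_apply]
      map_mul' := fun v w => by
        refine RingHom.ext fun y => ?_
        obtain ⟨y, rfl⟩ := Ideal.Quotient.mk_surjective y
        have : ⇑(DistribSMul.toAddMonoidHom M (v * w)) =
            ⇑(DistribSMul.toAddMonoidHom M v) ∘ ⇑(DistribSMul.toAddMonoidHom M w) := by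
          funext m; simp [mul_smul]
        simp only [FormalGroupAlgebra.map, Ideal.quotientMap_mk, this, RingHom.mul_def,
          RingHom.comp_apply, renameVars_renameVars] }
  x μ := Ideal.Quotient.mk _ (AdicCompletion.of _ _ (MvPolynomial.X μ))
  act_x w μ := by
    simp only [MonoidHom.coe_mk, OneHom.coe_mk, FormalGroupAlgebra.map, Ideal.quotientMap_mk,
      renameVars_of, MvPolynomial.rename_X, DistribSMul.toAddMonoidHom_apply]

/-- The polynomial version for the connective formal group law, with
`w(x_μ) = x_{w(μ)}`. -/
def connectiveRing {R : Type*} [CommRing R] (P : RootPairing ι ℤ M N) (c : R) :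
    EquivariantRing P (ConnectiveAlgebra c M) where
  act :=
    { toFun := fun w => ConnectiveAlgebra.map c (DistribSMul.toAddMonoidHom M w)
      map_one' := by
        refine RingHom.ext fun y => ?_
        obtain ⟨y, rfl⟩ := Ideal.Quotient.mk_surjective y
        have : ⇑(DistribSMul.toAddMonoidHom M (1 : P.weylGroup)) = id := by
          funext m; simp
        simp only [ConnectiveAlgebra.map, Ideal.quotientMap_mk, this, MvPolynomial.rename_id,
          RingHom.one_def, RingHom.id_apply, AlgHom.toRingHom_eq_coe, RingHom.coe_coe,
          AlgHom.id_apply]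
      map_mul' := fun v w => by
        refine RingHom.ext fun y => ?_
        obtain ⟨y, rfl⟩ := Ideal.Quotient.mk_surjective y
        have : ⇑(DistribSMul.toAddMonoidHom M (v * w)) =
            ⇑(DistribSMul.toAddMonoidHom M v) ∘ ⇑(DistribSMul.toAddMonoidHom M w) := by
          funext m; simp [mul_smul]
        simp only [ConnectiveAlgebra.map, Ideal.quotientMap_mk, this, RingHom.mul_def,
          RingHom.comp_apply, AlgHom.toRingHom_eq_coe, RingHom.coe_coe,
          MvPolynomial.rename_rename] }
  x μ := Ideal.Quotient.mk _ (MvPolynomial.X μ)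
  act_x w μ := by
    simp only [MonoidHom.coe_mk, OneHom.coe_mk, ConnectiveAlgebra.map, Ideal.quotientMap_mk,
      AlgHom.toRingHom_eq_coe, RingHom.coe_coe, MvPolynomial.rename_X,
      DistribSMul.toAddMonoidHom_apply]

end RootData

/-! ## Twisted group algebras and the formal affine Demazure algebra of the small torus -/

namespace EquivariantRing

variable {ι M N S : Type*} [AddCommGroup M] [AddCommGroup N] [CommRing S]
  {P : RootPairing ι ℤ M N} (E : EquivariantRing P S)

/-- The multiplicative set generated by the `x_α`, `α ∈ Φ`. -/
def rootSubmonoid : Submonoid S :=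
  Submonoid.closure (Set.range fun i => E.x (P.root i))

theorem rootSubmonoid_le_comap (w : P.weylGroup) :
    E.rootSubmonoid ≤ E.rootSubmonoid.comap (E.act w) := by
  rw [rootSubmonoid, Submonoid.closure_le]
  rintro _ ⟨i, rfl⟩
  rw [SetLike.mem_coe, Submonoid.mem_comap, E.act_x, RootPairing.weylGroup_apply_root]
  exact Submonoid.subset_closure ⟨_, rfl⟩

/-- `𝒬 = S[1/x_α, α ∈ Φ]`. -/
def Q : Type _ := Localization E.rootSubmonoid

instance : CommRing E.Q := inferInstanceAs (CommRing (Localization E.rootSubmonoid))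
instance : Algebra S E.Q := inferInstanceAs (Algebra S (Localization E.rootSubmonoid))
instance : IsLocalization E.rootSubmonoid E.Q :=
  inferInstanceAs (IsLocalization E.rootSubmonoid (Localization E.rootSubmonoid))

/-- The element `1/x_α` of `𝒬`, for a root `α`. -/
def invX (α : M) (hα : α ∈ Set.range P.root) : E.Q :=
  IsLocalization.mk' E.Q (1 : S)
    (⟨E.x α, Submonoid.subset_closure (by obtain ⟨i, rfl⟩ := hα; exact ⟨i, rfl⟩)⟩ :
      E.rootSubmonoid)

/-- The action of the finite Weyl group on `𝒬`. -/
def actQ : P.weylGroup →* (E.Q →+* E.Q) where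
  toFun w := IsLocalization.map E.Q (E.act w) (E.rootSubmonoid_le_comap w)
  map_one' := by
    apply IsLocalization.ringHom_ext E.rootSubmonoid
    rw [IsLocalization.map_comp, map_one]
    rfl
  map_mul' v w := by
    apply IsLocalization.ringHom_ext E.rootSubmonoid
    rw [IsLocalization.map_comp, RingHom.mul_def, RingHom.comp_assoc, IsLocalization.map_comp,
      ← RingHom.comp_assoc, IsLocalization.map_comp, map_mul, RingHom.mul_def,
      RingHom.comp_assoc]

/-- The affine Weyl group acts on `𝒬` through `W_a → W`: translations act trivially. -/
instance : MulSemiringAction (AffineWeylGroup P) E.Q :=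
  MulSemiringAction.compHom E.Q (E.actQ.comp SemidirectProduct.rightHom)

/-- The action of `Q^∨ ⊆ W_a` on `𝒬`. -/
instance : MulSemiringAction (Multiplicative N) E.Q :=
  MulSemiringAction.compHom E.Q
    (SemidirectProduct.inl : Multiplicative N →* AffineWeylGroup P)

/-- The twisted group algebra `𝒬_{W_a} = 𝒬 ⋊ R[W_a]`, with product
`c η_w c' η_{w'} = c w(c') η_{ww'}`; the element `c η_w` is `single w c`. -/
abbrev QWa : Type _ := SkewMonoidAlgebra E.Q (AffineWeylGroup P)

/-- The twisted group algebra `𝒬_{Q^∨} = 𝒬 ⋊ R[Q^∨]`. -/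
abbrev QCoroot : Type _ := SkewMonoidAlgebra E.Q (Multiplicative N)

/-- The canonical ring embedding `k : 𝒬_{Q^∨} → 𝒬_{W_a}`,
`p η_{t_λ} ↦ p η_{t_λ}`. -/
def k : E.QCoroot →+* E.QWa :=
  mapDomainRingHom (f := (SemidirectProduct.inl : Multiplicative N →* AffineWeylGroup P))
    (fun _ _ => rfl)

/-- The projection `pr : 𝒬_{W_a} → 𝒬_{Q^∨}`, `c η_{t_λ w} ↦ c η_{t_λ}`. -/
def pr : E.QWa →+ E.QCoroot :=
  mapDomain (fun u : AffineWeylGroup P => u.left)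

/-- The embedding `S → 𝒬 → 𝒬_{W_a}`. -/
def ofS : S →+* E.QWa :=
  singleOneRingHom.comp (algebraMap S E.Q)

/-- The Demazure element `X_i = (1/x_{α_i}) (1 - η_{s_i})` of a finite root. -/
def demazure (i : ι) : E.QWa :=
  single 1 (E.invX (P.root i) ⟨i, rfl⟩) * (1 - single (finiteReflection P i) 1)

/-- The Demazure element `X_0 = (1/x_{-θ}) (1 - η_{s_0})`. -/
def demazureZero (θ : ι) : E.QWa :=
  single 1 (E.invX (-P.root θ) (P.neg_root_mem θ)) * (1 - single (affineReflection P θ) 1)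

/-- The formal affine Demazure algebra `𝐃_{W_a}` of the small torus: the subalgebra of
`𝒬_{W_a}` generated by `S` and `X_i`, `i ∈ I_a = {0} ∪ I`. (It contains the scalars `R`, since
`S` does.) -/
def fada (b : P.Base) (θ : ι) : Subring E.QWa :=
  Subring.closure (Set.range E.ofS ∪ E.demazure '' b.support ∪ {E.demazureZero θ})

/-- `𝐃_{W_a/W} = pr(𝐃_{W_a})`. -/
def fadaModW (b : P.Base) (θ : ι) : Set E.QCoroot :=
  E.pr '' (E.fada b θ)

/-- The centralizer of `S` in `𝐃_{W_a}`. -/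
def centralizerS (b : P.Base) (θ : ι) : Set E.QWa :=
  {z | z ∈ E.fada b θ ∧ ∀ s : S, E.ofS s * z = z * E.ofS s}

/-- The Peterson subalgebra `𝐃_{Q^∨} = k(𝐃_{W_a/W})`. -/
def petersonSubalgebra (b : P.Base) (θ : ι) : Set E.QWa :=
  E.k '' (E.fadaModW b θ)

end EquivariantRing

end Peterson

end

/-!
The theorem follows from one identity in the twisted group algebra, which describes how the Demazure
elements act through `pr`, together with the fact that `W` acts faithfully on a domain.

*The Peterson subalgebra lies in `𝐃_{W_a}`.* Let `y ∈ k(𝒬_{Q^∨})`. As translations act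
trivially, `y` commutes with `𝒬`. For an element `X = (1/x_α)(1 - η_u)` of `𝒬_{W_a}` in which the
finite part of `u` is a reflection `s_β`, one finds (`EquivariantRing.k_pr_mul_k`)
`k(pr(X y)) = X y + (x_{-β}/x_α) η_u y X_β`.
For `X = X_i` (`α = β = α_i`) and `X = X_0` (`α = -θ`, `β = θ`) the coefficient lies in `S`, as
`F(x_β, x_{-β}) = 0` forces `x_β` to divide `x_{-β}`; and
`X_β ∈ 𝐃_{W_a}` for every root `β`, because `β` is conjugate under `W` to a simple root. So
`y ↦ k(pr(X y))` preserves `k(𝒬_{Q^∨}) ∩ 𝐃_{W_a}` when `X` is a generator. Since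
`pr(u z) = pr(u k(pr(z)))` (`EquivariantRing.pr_mul_k_pr`), the same holds for every
`X ∈ 𝐃_{W_a}`, and `y = 1` gives `k(pr(X)) ∈ 𝐃_{W_a}` (`EquivariantRing.k_pr_mem_fada`).

*The centralizer lies in `k(𝒬_{Q^∨})`.* If `Σ c_u η_u` commutes with `S` then
`c_u (u(s) - s) = 0` for all `u` and `s`, so it is enough that every `w ≠ 1` in `W` moves some
element of `S` by a nonzerodivisor. For this `S` is embedded in a power series ring `R[[t_i]]`, with
one variable for each element of a basis of the lattice, by `x_μ ↦ [μ]`, where `μ ↦ [μ]` is the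
homomorphism from the lattice to the points of the formal group that sends the `i`-th basis
vector to `t_i` (`formalEmbedding_injective`, `connectiveEmbedding_injective`). The linear part of
`[μ]` is `Σ μ_i t_i`, so in characteristic `0` distinct weights have distinct images.
-/

noncomputable section

namespace Peterson

/-! ### Reflections in the Weyl group -/

section WeylGroup

variable {ι M N : Type*} [AddCommGroup M] [AddCommGroup N] {P : RootPairing ι ℤ M N}

theorem weylGroup_eq_one_of_smul_eq {w : P.weylGroup} (h : ∀ m : M, w • m = m) : w = 1 := by
  apply Subtype.ext
  apply RootPairing.Equiv.weightHom_injective P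
  apply LinearEquiv.ext
  intro m
  simpa using! h m

theorem weylGroup_ofIdx_smul_root (i j : ι) :
    RootPairing.weylGroup.ofIdx P i • P.root j = P.root (P.reflectionPerm i j) := by
  rw [RootPairing.weylGroup.ofIdx_smul, RootPairing.Equiv.reflection_smul,
    RootPairing.root_reflectionPerm]

theorem weylGroup_ofIdx_mul_self (i : ι) :
    RootPairing.weylGroup.ofIdx P i * RootPairing.weylGroup.ofIdx P i = 1 := by
  apply weylGroup_eq_one_of_smul_eq
  intro m
  rw [mul_smul]
  simp

theorem weylGroup_ofIdx_eq_conj (i j : ι) :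
    RootPairing.weylGroup.ofIdx P (P.reflectionPerm j i) =
      RootPairing.weylGroup.ofIdx P j * RootPairing.weylGroup.ofIdx P i *
        RootPairing.weylGroup.ofIdx P j := by
  rw [← mul_inv_eq_one]
  apply weylGroup_eq_one_of_smul_eq
  intro m
  rw [mul_smul, ← eq_inv_smul_iff, inv_eq_iff_mul_eq_one.2 (weylGroup_ofIdx_mul_self _)]
  rw [mul_inv_rev, mul_inv_rev]
  simp only [inv_eq_iff_mul_eq_one.2 (weylGroup_ofIdx_mul_self _), mul_smul,
    RootPairing.weylGroup.ofIdx_smul, RootPairing.Equiv.reflection_smul]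
  rw [RootPairing.reflection_reflectionPerm]
  rfl

theorem weylGroup_ofIdx_reflectionPerm_self (i : ι) :
    RootPairing.weylGroup.ofIdx P (P.reflectionPerm i i) = RootPairing.weylGroup.ofIdx P i := by
  rw [weylGroup_ofIdx_eq_conj, mul_assoc, weylGroup_ofIdx_mul_self, mul_one]

end WeylGroup

/-! ### The affine Demazure algebra and its projection to translations -/

namespace EquivariantRing

open SkewMonoidAlgebra

variable {ι M N S : Type*} [AddCommGroup M] [AddCommGroup N] [CommRing S]
  {P : RootPairing ι ℤ M N} (E : EquivariantRing P S)

theorem smul_algebraMap (u : AffineWeylGroup P) (s : S) :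
    u • algebraMap S E.Q s = algebraMap S E.Q (E.act u.right s) :=
  IsLocalization.map_eq (E.rootSubmonoid_le_comap u.right) s

theorem smul_x (u : AffineWeylGroup P) (μ : M) :
    u • algebraMap S E.Q (E.x μ) = algebraMap S E.Q (E.x (u.right • μ)) := by
  rw [smul_algebraMap, act_x]

theorem smul_of_right_eq_one {u : AffineWeylGroup P} (h : u.right = 1) (q : E.Q) : u • q = q := by
  change E.actQ u.right q = q
  rw [h, map_one]
  rfl

@[simp]
theorem inl_smul (l : Multiplicative N) (q : E.Q) :
    (SemidirectProduct.inl l : AffineWeylGroup P) • q = q :=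
  E.smul_of_right_eq_one (SemidirectProduct.right_inl l) q

theorem x_mul_invX {α : M} (hα : α ∈ Set.range P.root) :
    algebraMap S E.Q (E.x α) * E.invX α hα = 1 := by
  rw [invX, IsLocalization.mul_mk'_eq_mk'_of_mul, mul_one]
  exact IsLocalization.mk'_self E.Q (x := E.x α) _

theorem eq_invX_of_x_mul_eq_one {α : M} (hα : α ∈ Set.range P.root) {q : E.Q}
    (h : algebraMap S E.Q (E.x α) * q = 1) : q = E.invX α hα := by
  have := E.x_mul_invX hα
  linear_combination E.invX α hα * h - q * this

theorem smul_invX (u : AffineWeylGroup P) {α β : M} (hα : α ∈ Set.range P.root)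
    (hβ : β ∈ Set.range P.root) (h : u.right • α = β) : u • E.invX α hα = E.invX β hβ := by
  apply E.eq_invX_of_x_mul_eq_one
  rw [← h, ← E.smul_x, ← smul_mul', E.x_mul_invX, smul_one]

@[simp]
theorem k_single (l : Multiplicative N) (q : E.Q) :
    E.k (single l q) = single (SemidirectProduct.inl l) q :=
  mapDomain_single

@[simp]
theorem pr_single (u : AffineWeylGroup P) (q : E.Q) : E.pr (single u q) = single u.left q :=
  mapDomain_single

theorem pr_k (y : E.QCoroot) : E.pr (E.k y) = y := by
  induction y using SkewMonoidAlgebra.induction_on with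
  | zero => simp
  | single l q => simp
  | add a b ha hb => rw [map_add, map_add, ha, hb]

/-- `pr` exhibits `𝒬_{Q^∨}` as the left `𝒬_{W_a}`-module induced from the trivial
character of `W`. -/
theorem pr_mul_k_pr (u z : E.QWa) : E.pr (u * E.k (E.pr z)) = E.pr (u * z) := by
  induction u using SkewMonoidAlgebra.induction_on with
  | zero => simp
  | add a b ha hb => rw [add_mul, add_mul, map_add, map_add, ha, hb]
  | single u q =>
    induction z using SkewMonoidAlgebra.induction_on with
    | zero => simp
    | add a b ha hb => rw [mul_add, map_add, map_add, map_add, mul_add, map_add, ha, hb]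
    | single v q' => simp

theorem k_pr_single_mul_k (u : AffineWeylGroup P) (y : E.QCoroot) :
    E.k (E.pr (single u 1 * E.k y)) =
      single u 1 * E.k y * single (SemidirectProduct.inr u.right⁻¹) 1 := by
  induction y using SkewMonoidAlgebra.induction_on with
  | zero => simp
  | add a b ha hb => simp only [map_add, mul_add, add_mul, ha, hb]
  | single l q =>
    simp only [k_single, single_mul_single, pr_single, smul_one, mul_one, one_mul]
    congr 1
    ext <;> simp

theorem k_pr_single_one_mul (q : E.Q) (z : E.QWa) :
    E.k (E.pr (single 1 q * z)) = single 1 q * E.k (E.pr z) := by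
  induction z using SkewMonoidAlgebra.induction_on with
  | zero => simp
  | add a b ha hb => simp only [map_add, mul_add, ha, hb]
  | single u q' => simp

/-- Translations act trivially on `𝒬`, so `𝒬` is central in `k(𝒬_{Q^∨})`. -/
theorem single_one_mul_k (q : E.Q) (y : E.QCoroot) :
    single 1 q * E.k y = E.k y * single 1 q := by
  induction y using SkewMonoidAlgebra.induction_on with
  | zero => simp
  | add a b ha hb => simp only [map_add, mul_add, add_mul, ha, hb]
  | single l q' => simp [mul_comm]

theorem ofS_apply (s : S) : E.ofS s = single 1 (algebraMap S E.Q s) := rfl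

section Fada

variable (b : P.Base) (θ : ι)

theorem ofS_mem_fada (s : S) : E.ofS s ∈ E.fada b θ :=
  Subring.subset_closure (Or.inl (Or.inl ⟨s, rfl⟩))

theorem demazure_mem_fada_of_mem_support {i : ι} (hi : i ∈ b.support) :
    E.demazure i ∈ E.fada b θ :=
  Subring.subset_closure (Or.inl (Or.inr ⟨i, hi, rfl⟩))

theorem demazureZero_mem_fada : E.demazureZero θ ∈ E.fada b θ :=
  Subring.subset_closure (Or.inr rfl)

variable {b θ}

theorem ofS_x_mul_invX_mul {α : M} (hα : α ∈ Set.range P.root) (z : E.QWa) :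
    E.ofS (E.x α) * (single 1 (E.invX α hα) * z) = z := by
  rw [ofS_apply, ← mul_assoc, single_mul_single, one_smul, x_mul_invX, mul_one, ← one_def,
    one_mul]

theorem single_mem_fada_of_invX {u : AffineWeylGroup P} {α : M} (hα : α ∈ Set.range P.root)
    (h : single 1 (E.invX α hα) * (1 - single u 1) ∈ E.fada b θ) :
    (single u 1 : E.QWa) ∈ E.fada b θ := by
  have := sub_mem (one_mem _) (mul_mem (E.ofS_mem_fada b θ (E.x α)) h)
  rwa [ofS_x_mul_invX_mul, sub_sub_cancel] at this

theorem demazure_reflectionPerm_self_mem_fada (hneg : ∀ μ, E.x (-μ) ∣ E.x μ) {i : ι}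
    (h : E.demazure i ∈ E.fada b θ) : E.demazure (P.reflectionPerm i i) ∈ E.fada b θ := by
  have hr : P.root (P.reflectionPerm i i) = -P.root i := by simp
  obtain ⟨a, ha⟩ := hneg (P.root i)
  convert mul_mem (E.ofS_mem_fada b θ a) h using 1
  rw [demazure, demazure, ofS_apply, ← mul_assoc, single_mul_single]
  congr 2
  · rw [mul_one]
  · symm
    rw [one_smul]
    apply E.eq_invX_of_x_mul_eq_one
    rw [hr, ← mul_assoc, ← map_mul, ← ha]
    exact E.x_mul_invX ⟨i, rfl⟩
  · rw [finiteReflection, finiteReflection, weylGroup_ofIdx_reflectionPerm_self]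

theorem demazure_reflectionPerm_mem_fada {i j : ι} (hi : E.demazure i ∈ E.fada b θ)
    (hj : E.demazure j ∈ E.fada b θ) : E.demazure (P.reflectionPerm j i) ∈ E.fada b θ := by
  have hs := E.single_mem_fada_of_invX _ hj
  convert mul_mem (mul_mem hs hi) hs using 1
  have e1 : finiteReflection P j * finiteReflection P j = 1 := by
    ext <;> simp [finiteReflection, weylGroup_ofIdx_mul_self]
  have e2 : finiteReflection P (P.reflectionPerm j i) =
      finiteReflection P j * finiteReflection P i * finiteReflection P j := by
    ext <;> simp [finiteReflection, weylGroup_ofIdx_eq_conj]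
  have e3 : finiteReflection P j • E.invX (P.root i) ⟨i, rfl⟩ =
      E.invX (P.root (P.reflectionPerm j i)) ⟨_, rfl⟩ :=
    E.smul_invX _ _ _ (weylGroup_ofIdx_smul_root j i)
  rw [demazure, demazure]
  simp only [mul_sub, sub_mul, single_mul_single, mul_one, one_mul, smul_one, e1, e2, e3]

/-- The Demazure element of every finite root lies in the affine Demazure algebra: it is obtained
from that of a simple root by conjugating with elements `η_w`, `w ∈ W`. -/
theorem demazure_mem_fada [Finite ι] [P.IsReduced] (hneg : ∀ μ, E.x (-μ) ∣ E.x μ) (i : ι) :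
    E.demazure i ∈ E.fada b θ := by
  induction i using b.induction_reflect with
  | h₀ i hi => exact E.demazure_reflectionPerm_self_mem_fada hneg hi
  | h₁ i hi => exact E.demazure_mem_fada_of_mem_support b θ hi
  | h₂ i j hi hj =>
    exact E.demazure_reflectionPerm_mem_fada hi (E.demazure_mem_fada_of_mem_support b θ hj)

/-- The key computation: for `u ∈ W_a` with finite part `s_β` and `y ∈ 𝒬_{Q^∨}`, the
element `k(pr((1/x_α)(1 - η_u) y))` equals
`(1/x_α)(1 - η_u) y + (x_{-β}/x_α) η_u y X_β`. -/
theorem k_pr_mul_k {α : M} (hα : α ∈ Set.range P.root) {u : AffineWeylGroup P} {β : ι}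
    (hu : u.right = RootPairing.weylGroup.ofIdx P β) {s : S} (hs : E.x (-P.root β) = E.x α * s)
    (y : E.QCoroot) :
    E.k (E.pr (single 1 (E.invX α hα) * (1 - single u 1) * E.k y)) =
      single 1 (E.invX α hα) * (1 - single u 1) * E.k y +
        E.ofS s * single u 1 * E.k y * E.demazure β := by
  have hinv : (SemidirectProduct.inr u.right⁻¹ : AffineWeylGroup P) = finiteReflection P β := by
    rw [hu, inv_eq_iff_mul_eq_one.2 (weylGroup_ofIdx_mul_self _)]
    rfl
  have hc : E.ofS s * single u 1 =
      single 1 (E.invX α hα) * (single u 1 * E.ofS (E.x (P.root β))) := by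
    have hx : u • algebraMap S E.Q (E.x (P.root β)) = algebraMap S E.Q (E.x α * s) := by
      rw [E.smul_x, hu, weylGroup_ofIdx_smul_root, ← hs]
      simp
    simp only [ofS_apply, single_mul_single, one_smul, one_mul, mul_one, hx, map_mul]
    congr 1
    linear_combination -algebraMap S E.Q s * E.x_mul_invX hα
  have hd : E.ofS (E.x (P.root β)) * E.demazure β = 1 - single (finiteReflection P β) 1 :=
    E.ofS_x_mul_invX_mul _ _
  have hcomm : E.ofS (E.x (P.root β)) * E.k y = E.k y * E.ofS (E.x (P.root β)) :=
    E.single_one_mul_k _ _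
  calc E.k (E.pr (single 1 (E.invX α hα) * (1 - single u 1) * E.k y))
      = single 1 (E.invX α hα) *
          (E.k y - single u 1 * E.k y * single (finiteReflection P β) 1) := by
        rw [mul_assoc, k_pr_single_one_mul, sub_mul, one_mul, map_sub, map_sub, pr_k,
          k_pr_single_mul_k, hinv]
    _ = single 1 (E.invX α hα) * (1 - single u 1) * E.k y +
          single 1 (E.invX α hα) * (single u 1 * (E.k y *
            (1 - single (finiteReflection P β) 1))) := by noncomm_ring
    _ = _ := by
        rw [← hd, ← mul_assoc (E.k y), ← hcomm, hc]
        noncomm_ring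

theorem k_pr_mem_fada [Finite ι] [P.IsReduced] (hneg : ∀ μ, E.x (-μ) ∣ E.x μ) {z : E.QWa}
    (hz : z ∈ E.fada b θ) : E.k (E.pr z) ∈ E.fada b θ := by
  -- The elements `u` for which `y ↦ k(pr(u y))` preserves `k(𝒬_{Q^∨}) ∩ 𝐃` form a subring.
  suffices h : ∀ y, E.k y ∈ E.fada b θ → E.k (E.pr (z * E.k y)) ∈ E.fada b θ by
    simpa using h 1 (by simp)
  have gen : ∀ {α : M} (hα : α ∈ Set.range P.root) {u : AffineWeylGroup P} {β : ι}
      (_ : u.right = RootPairing.weylGroup.ofIdx P β) {s : S}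
      (_ : E.x (-P.root β) = E.x α * s)
      (_ : single 1 (E.invX α hα) * (1 - single u 1) ∈ E.fada b θ),
      ∀ y, E.k y ∈ E.fada b θ →
        E.k (E.pr (single 1 (E.invX α hα) * (1 - single u 1) * E.k y)) ∈ E.fada b θ := by
    intro α hα u β hu s hs h y hy
    rw [E.k_pr_mul_k hα hu hs]
    exact add_mem (mul_mem h hy) (mul_mem (mul_mem (mul_mem (E.ofS_mem_fada b θ s)
      (E.single_mem_fada_of_invX hα h)) hy) (E.demazure_mem_fada hneg β))
  induction hz using Subring.closure_induction with
  | mem z hz =>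
    rcases hz with (⟨s, rfl⟩ | ⟨i, hi, rfl⟩) | rfl
    · intro y hy
      rw [ofS_apply, k_pr_single_one_mul, pr_k]
      exact mul_mem (E.ofS_mem_fada b θ s) hy
    · obtain ⟨s, hs⟩ := hneg (-P.root i)
      rw [neg_neg] at hs
      exact gen ⟨i, rfl⟩ rfl hs (E.demazure_mem_fada_of_mem_support b θ hi)
    · exact gen (P.neg_root_mem θ) (β := θ) rfl (s := 1) (mul_one _).symm
        (E.demazureZero_mem_fada b θ)
  | zero => simp
  | one => intro y hy; rwa [one_mul, pr_k]
  | add u v _ _ hu hv =>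
    intro y hy
    rw [add_mul, map_add, map_add]
    exact add_mem (hu y hy) (hv y hy)
  | neg u _ hu =>
    intro y hy
    rw [neg_mul, map_neg, map_neg]
    exact neg_mem (hu y hy)
  | mul u v _ _ hu hv =>
    intro y hy
    rw [mul_assoc, ← pr_mul_k_pr]
    exact hu _ (hv y hy)

theorem k_pr_eq_self_of_commute
    (hreg : ∀ w : P.weylGroup, w ≠ 1 → ∃ s, E.act w s - s ∈ nonZeroDivisors S) {z : E.QWa}
    (hz : ∀ s, E.ofS s * z = z * E.ofS s) : E.k (E.pr z) = z := by
  have hsupp : ∀ u, u.right ≠ 1 → z.coeff u = 0 := by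
    intro u hu
    obtain ⟨s, hs⟩ := hreg _ hu
    have h := congrArg (fun a => a.coeff u) (hz s)
    simp only [ofS_apply, coeff_single_one_mul, coeff_mul_single_one, smul_algebraMap] at h
    have hs' := IsLocalization.map_nonZeroDivisors_le E.rootSubmonoid E.Q
      (Submonoid.mem_map_of_mem _ hs)
    refine (mem_nonZeroDivisors_iff.1 hs').2 _ ?_
    rw [map_sub]
    linear_combination -h
  have hk : E.k (E.pr z) = z.sum fun u q => single (SemidirectProduct.inl u.left) q := by
    conv_lhs => rw [← sum_single z]
    simp [sum_def, Finsupp.sum]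
  rw [hk]
  conv_rhs => rw [← sum_single z]
  rw [sum_def, sum_def]
  refine Finset.sum_congr rfl fun u hu => ?_
  have hr : u.right = 1 := by
    by_contra h
    exact (Finsupp.mem_support_iff.1 hu) (hsupp u h)
  have hu' : SemidirectProduct.inl u.left = u := by ext <;> simp [hr]
  simp only [hu']

/-- The centralizer theorem for any equivariant ring in which `x_{-μ}` divides `x_μ` and each
non-trivial `w ∈ W` moves some element by a nonzerodivisor. -/
theorem centralizerS_eq [Finite ι] [P.IsReduced] (b : P.Base) (θ : ι)
    (hneg : ∀ μ, E.x (-μ) ∣ E.x μ)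
    (hreg : ∀ w : P.weylGroup, w ≠ 1 → ∃ s, E.act w s - s ∈ nonZeroDivisors S) :
    E.centralizerS b θ = Set.range E.k ∩ (E.fada b θ) ∧
      Set.range E.k ∩ (E.fada b θ) = E.k '' (E.fadaModW b θ) ∧
      E.petersonSubalgebra b θ = E.centralizerS b θ := by
  have h1 : E.centralizerS b θ = Set.range E.k ∩ (E.fada b θ) := by
    ext z
    constructor
    · rintro ⟨hz, hc⟩
      exact ⟨⟨E.pr z, E.k_pr_eq_self_of_commute hreg hc⟩, hz⟩
    · rintro ⟨⟨y, rfl⟩, hz⟩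
      exact ⟨hz, fun s => E.single_one_mul_k _ y⟩
  have h2 : Set.range E.k ∩ (E.fada b θ) = E.k '' (E.fadaModW b θ) := by
    ext z
    constructor
    · rintro ⟨⟨y, rfl⟩, hz⟩
      exact ⟨y, ⟨_, hz, E.pr_k y⟩, rfl⟩
    · rintro ⟨_, ⟨z, hz, rfl⟩, rfl⟩
      exact ⟨⟨_, rfl⟩, E.k_pr_mem_fada hneg hz⟩
  exact ⟨h1, h2, (h1.trans h2).symm⟩

end Fada

end EquivariantRing

/-! ### Points of a formal group in a power series ring -/

section FormalGroupPoints

open MvPowerSeries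

variable {R σ : Type*} [CommRing R]

theorem coeff_toPowerSeries_of_apply_one_eq_zero (F : FormalGroup R) {m : Fin 2 →₀ ℕ}
    (hm : m 1 = 0) : coeff m F.toPowerSeries = coeff m (X 0 : MvPowerSeries (Fin 2) R) := by
  have hX : PowerSeries.HasSubst (X 0 : MvPowerSeries (Fin 2) R) := by
    simp [PowerSeries.HasSubst]
  have h := congrArg (coeff m) (F.add_zero hX)
  rw [coeff_subst HasSubst.X_zero, finsum_eq_single _ m] at h
  · rw [← h, Finsupp.prod_fintype _ _ (by simp), Fin.prod_univ_two]
    have hm' : m = Finsupp.single 0 (m 0) := by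
      ext i
      fin_cases i <;> simp [hm]
    simp only [Matrix.cons_val_zero, Matrix.cons_val_one, hm, pow_zero, mul_one]
    rw [coeff_X_pow, if_pos hm', smul_eq_mul, mul_one]
  · intro d hd
    rw [Finsupp.prod_fintype _ _ (by simp), Fin.prod_univ_two]
    simp only [Matrix.cons_val_zero, Matrix.cons_val_one, Matrix.cons_val_fin_one]
    rcases eq_or_ne (d 1) 0 with h1 | h1
    · rw [h1, pow_zero, mul_one, coeff_X_pow, if_neg, smul_zero]
      rintro rfl
      apply hd
      ext i
      fin_cases i <;> simp_all
    · rw [zero_pow h1, mul_zero, map_zero, smul_zero]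

theorem coeff_mul_of_degree_one {f g : MvPowerSeries σ R} (hf : constantCoeff f = 0) (i : σ) :
    coeff (Finsupp.single i 1) (f * g) = coeff (Finsupp.single i 1) f * constantCoeff g := by
  classical
  rw [coeff_mul, Finsupp.antidiagonal_single]
  simp [Finset.Nat.antidiagonal_succ, hf]

/-- A formal group law has the form `F(X, Y) = X + Y G(X, Y)` with `G(0, 0) = 1`. -/
theorem exists_toPowerSeries_eq (F : FormalGroup R) :
    ∃ G : MvPowerSeries (Fin 2) R,
      F.toPowerSeries = X 0 + X 1 * G ∧ constantCoeff G = 1 := by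
  obtain ⟨G, hG⟩ : (X 1 : MvPowerSeries (Fin 2) R) ∣ F.toPowerSeries - X 0 := by
    rw [X_dvd_iff]
    intro m hm
    rw [map_sub, coeff_toPowerSeries_of_apply_one_eq_zero F hm, sub_self]
  rw [sub_eq_iff_eq_add'] at hG
  refine ⟨G, hG, ?_⟩
  have h := F.lin_coeff_Y
  rw [hG, map_add, coeff_index_single_X, if_neg (by simp), zero_add, coeff_mul_of_degree_one (by simp),
    coeff_index_single_self_X, one_mul] at h
  exact h

variable {F : FormalGroup R}

theorem hasSubst_pair {f g : MvPowerSeries σ R} (hf : constantCoeff f = 0)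
    (hg : constantCoeff g = 0) : HasSubst ![f, g] :=
  hasSubst_of_constantCoeff_zero fun s => by fin_cases s <;> simpa

theorem exists_subst_eq (F : FormalGroup R) {f g : MvPowerSeries σ R}
    (hf : constantCoeff f = 0) (hg : constantCoeff g = 0) :
    ∃ h : MvPowerSeries σ R, constantCoeff h = 1 ∧ F.toPowerSeries.subst ![f, g] = f + g * h := by
  obtain ⟨G, hG, hG1⟩ := exists_toPowerSeries_eq F
  have hs := hasSubst_pair hf hg
  refine ⟨G.subst ![f, g], ?_, ?_⟩
  · have : constantCoeff ((G - 1).subst ![f, g]) = 0 := by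
      apply constantCoeff_subst_eq_zero hs
      · intro i
        fin_cases i <;> simpa
      · simp [hG1]
    rw [subst_sub hs, ← coe_substAlgHom hs, map_one, coe_substAlgHom hs, map_sub, map_one,
      sub_eq_zero] at this
    exact this
  · rw [hG, subst_add hs, subst_mul hs, subst_X hs, subst_X hs]
    rfl

theorem one_le_order {f : MvPowerSeries σ R} (hf : constantCoeff f = 0) : 1 ≤ f.order :=
  one_le_order_iff_constCoeff_eq_zero.2 hf

variable [IsDomain R]

theorem point_constantCoeff (p : F.Point σ) : constantCoeff p.val = 0 :=
  IsNilpotent.eq_zero p.prop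

/-- The coefficient of `t_i` as an additive function on the points of a formal group. -/
def linearCoeff (F : FormalGroup R) (i : σ) : F.Point σ →+ R where
  toFun p := coeff (Finsupp.single i 1) p.val
  map_zero' := by simp
  map_add' p q := by
    obtain ⟨h, h1, h2⟩ := exists_subst_eq F (point_constantCoeff p) (point_constantCoeff q)
    rw [FormalGroup.add_apply, h2, map_add, coeff_mul_of_degree_one (point_constantCoeff q), h1,
      mul_one]

/-- The point `-p`, the negative being taken in the ring of power series. -/
def ringNeg (p : F.Point σ) : F.Point σ :=
  ⟨-p.val, by simp [PowerSeries.HasSubst, point_constantCoeff]⟩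

theorem order_add_ringNeg (p : F.Point σ) : p.val.order + 1 ≤ (p + ringNeg p).val.order := by
  obtain ⟨h, h1, h2⟩ :=
    exists_subst_eq F (point_constantCoeff p) (point_constantCoeff (ringNeg p))
  have : (p + ringNeg p).val = p.val * (1 - h) := by
    rw [FormalGroup.add_apply, h2, ringNeg]
    ring
  rw [this]
  exact (add_le_add le_rfl (one_le_order (by simp [h1]))).trans le_order_mul

theorem order_add_sub (p q : F.Point σ) : q.val.order ≤ ((p + q).val - p.val).order := by
  obtain ⟨h, h1, h2⟩ := exists_subst_eq F (point_constantCoeff p) (point_constantCoeff q)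
  rw [FormalGroup.add_apply, h2, add_sub_cancel_left]
  exact le_self_add.trans le_order_mul

/-- Successive approximations to the inverse of a point `p`: the error `r = p + b_n` is cancelled
up to higher order by adding `-r`. -/
def negApprox (p : F.Point σ) : ℕ → F.Point σ
  | 0 => 0
  | n + 1 => negApprox p n + ringNeg (p + negApprox p n)

theorem order_add_negApprox (p : F.Point σ) (n : ℕ) :
    ((n + 1 : ℕ) : ℕ∞) ≤ (p + negApprox p n).val.order := by
  induction n with
  | zero =>
    rw [negApprox, add_zero]
    simpa using one_le_order (point_constantCoeff p)
  | succ n ih =>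
    rw [negApprox, ← add_assoc]
    refine le_trans ?_ (order_add_ringNeg _)
    push_cast at ih ⊢
    exact add_le_add ih le_rfl

theorem coeff_negApprox_succ (p : F.Point σ) {n : ℕ} {d : σ →₀ ℕ} (hd : d.degree ≤ n) :
    coeff d (negApprox p (n + 1)).val = coeff d (negApprox p n).val := by
  rw [← sub_eq_zero, ← map_sub]
  apply coeff_of_lt_order
  refine lt_of_lt_of_le ?_ (order_add_sub (negApprox p n) (ringNeg (p + negApprox p n)))
  rw [ringNeg, order_neg]
  exact lt_of_lt_of_le (by exact_mod_cast Nat.lt_succ_of_le hd) (order_add_negApprox p n)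

theorem coeff_negApprox (p : F.Point σ) {n : ℕ} {d : σ →₀ ℕ} (hd : d.degree ≤ n) :
    coeff d (negApprox p n).val = coeff d (negApprox p d.degree).val := by
  induction n, hd using Nat.le_induction with
  | base => rfl
  | succ n hn ih => rw [coeff_negApprox_succ p hn, ih]

theorem exists_point_add_eq_zero [Finite σ] (p : F.Point σ) : ∃ q : F.Point σ, p + q = 0 := by
  let g : MvPowerSeries σ R := fun d => coeff d (negApprox p d.degree).val
  have hg : ∀ d, coeff d g = coeff d (negApprox p d.degree).val := fun d => rfl
  have hg0 : constantCoeff g = 0 := by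
    rw [← coeff_zero_eq_constantCoeff_apply, hg]
    simp [negApprox]
  let q : F.Point σ := ⟨g, by simp [PowerSeries.HasSubst, hg0]⟩
  refine ⟨q, Subtype.ext ?_⟩
  rw [FormalGroup.add_apply, FormalGroup.zero_apply]
  change F.toPowerSeries.subst ![p.val, g] = 0
  ext d
  have ht : g.truncTotal (d.degree + 1) =
      (negApprox p d.degree).val.truncTotal (d.degree + 1) := by
    ext m
    by_cases hm : m.degree < d.degree + 1
    · rw [coeff_truncTotal _ hm, coeff_truncTotal _ hm, hg,
        coeff_negApprox p (Nat.le_of_lt_succ hm)]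
    · rw [coeff_truncTotal_eq_zero _ (not_lt.1 hm), coeff_truncTotal_eq_zero _ (not_lt.1 hm)]
  have hs : (F.toPowerSeries.subst ![p.val, g]).truncTotal (d.degree + 1) =
      (p + negApprox p d.degree).val.truncTotal (d.degree + 1) := by
    have h0 : ∀ f : MvPowerSeries σ R, constantCoeff f = 0 →
        ∀ i, constantCoeff (![p.val, f] i) = 0 := by
      intro f hf i
      fin_cases i
      · exact point_constantCoeff p
      · exact hf
    rw [FormalGroup.add_apply]
    refine (truncTotal_subst (h0 _ hg0)).trans
      (Eq.trans ?_ (truncTotal_subst (h0 _ (point_constantCoeff _))).symm)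
    congr 2
    funext i
    fin_cases i
    · rfl
    · simp [ht]
  have hlt := Nat.lt_succ_self d.degree
  rw [map_zero, ← coeff_truncTotal _ hlt, hs, coeff_truncTotal _ hlt]
  exact coeff_of_lt_order (lt_of_lt_of_le (by exact_mod_cast hlt) (order_add_negApprox p _))

instance [Finite σ] : Neg (F.Point σ) where
  neg p := (exists_point_add_eq_zero p).choose

/-- The points of a commutative formal group with values in a power series ring form a group. -/
instance [Finite σ] [F.IsComm] : AddCommGroup (F.Point σ) where
  neg_add_cancel p := by
    rw [add_comm]
    exact (exists_point_add_eq_zero p).choose_spec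
  zsmul := zsmulRec

variable {M : Type*} [AddCommGroup M] [Finite σ]

/-- The variable `t_i` as a point of a formal group. -/
def varPoint (F : FormalGroup R) (i : σ) : F.Point σ :=
  ⟨X i, by simp [PowerSeries.HasSubst]⟩

/-- The homomorphism from a lattice to the points of a formal group that sends the `i`-th basis
vector to the `i`-th variable. -/
def latticePoint (F : FormalGroup R) [F.IsComm] (e : Module.Basis σ ℤ M) : M →+ F.Point σ :=
  (e.constr ℤ (varPoint F)).toAddMonoidHom

theorem latticePoint_basis [F.IsComm] (e : Module.Basis σ ℤ M) (i : σ) :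
    (latticePoint F e (e i)).val = X i := by
  simp [latticePoint, varPoint]

theorem linearCoeff_latticePoint [F.IsComm] (e : Module.Basis σ ℤ M) (μ : M) (i : σ) :
    linearCoeff F i (latticePoint F e μ) = (e.repr μ i : ℤ) := by
  have : ((linearCoeff F i).comp (latticePoint F e)).toIntLinearMap =
      ((Int.castAddHom R).toIntLinearMap).comp (e.coord i) := by
    classical
    apply e.ext
    intro j
    have : linearCoeff F i (latticePoint F e (e j)) = if i = j then 1 else 0 := by
      change coeff _ (latticePoint F e (e j)).val = _
      rw [latticePoint_basis, coeff_index_single_X]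
    simp [this, Finsupp.single_apply, eq_comm]
  exact LinearMap.congr_fun this μ

theorem latticePoint_injective [CharZero R] [F.IsComm] (e : Module.Basis σ ℤ M) :
    Function.Injective (latticePoint F e) := by
  intro μ ν h
  apply e.ext_elem
  intro i
  have := congrArg (linearCoeff F i) h
  rw [linearCoeff_latticePoint, linearCoeff_latticePoint] at this
  exact_mod_cast this

end FormalGroupPoints

/-! ### The connective formal group law -/

section ConnectiveFormalGroup

open MvPowerSeries

variable {R : Type*} [CommRing R]

/-- The connective formal group law `F_c(x, y) = x + y - cxy`. -/
def connectiveFormalGroup (c : R) : FormalGroup R where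
  toPowerSeries := X 0 + X 1 - c • (X 0 * X 1)
  zero_constantCoeff := by simp
  lin_coeff_X := by
    rw [map_sub, map_add, coeff_smul, coeff_mul_of_degree_one (by simp)]
    simp [coeff_index_single_X]
  lin_coeff_Y := by
    rw [map_sub, map_add, coeff_smul, coeff_mul_of_degree_one (by simp)]
    simp [coeff_index_single_X]
  assoc := by
    have aux₁ := HasSubst.cons_subst_zero_left (R := R)
      (f := X 0 + X 1 - c • (X 0 * X 1)) (0 : Fin 3) 1 2 (by simp)
    have aux₂ := HasSubst.cons_subst_zero_right (R := R)
      (f := X 0 + X 1 - c • (X 0 * X 1)) (0 : Fin 3) 1 2 (by simp)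
    simp_rw [subst_sub aux₁, subst_add aux₁, subst_smul aux₁, subst_mul aux₁, subst_X aux₁,
      subst_sub aux₂, subst_add aux₂, subst_smul aux₂, subst_mul aux₂, subst_X aux₂]
    simp only [subst_sub .X_X, subst_add .X_X, subst_smul .X_X, subst_mul .X_X, subst_X .X_X,
      Matrix.cons_val_zero, Matrix.cons_val_one, Matrix.cons_val_fin_one]
    simp only [smul_eq_C_mul]
    ring

theorem connectiveFormalGroup_subst {σ : Type*} (c : R) {f g : MvPowerSeries σ R}
    (hf : constantCoeff f = 0) (hg : constantCoeff g = 0) :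
    (connectiveFormalGroup c).toPowerSeries.subst ![f, g] = f + g - C c * f * g := by
  have hs := hasSubst_pair hf hg
  simp only [connectiveFormalGroup, subst_sub hs, subst_add hs, subst_smul hs, subst_mul hs,
    subst_X hs, Matrix.cons_val_zero, Matrix.cons_val_one, Matrix.cons_val_fin_one]
  rw [smul_eq_C_mul, mul_assoc]

instance (c : R) : (connectiveFormalGroup c).IsComm where
  comm := by
    rw [connectiveFormalGroup_subst c (by simp) (by simp)]
    simp only [connectiveFormalGroup, smul_eq_C_mul]
    ring

end ConnectiveFormalGroup

/-! ### Evaluation of completed polynomials at power series -/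

section Evaluation

open MvPowerSeries

variable {R σ s : Type*} [CommRing R]

theorem le_order_of_mem_pow {n : ℕ} {f : MvPowerSeries σ R}
    (hf : f ∈ RingHom.ker (constantCoeff (σ := σ) (R := R)) ^ n) : (n : ℕ∞) ≤ f.order := by
  induction n generalizing f with
  | zero => simp
  | succ n ih =>
    rw [pow_succ] at hf
    induction hf using Submodule.mul_induction_on' with
    | mem_mul_mem a ha b hb =>
      push_cast
      exact (add_le_add (ih ha) (one_le_order hb)).trans le_order_mul
    | add a _ b _ ha hb => exact (le_min ha hb).trans min_order_le_add

theorem aeval_mem_ker_constantCoeff_pow {a : s → MvPowerSeries σ R}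
    (ha : ∀ i, constantCoeff (a i) = 0) (n : ℕ) {p : MvPolynomial s R}
    (hp : p ∈ MvPolynomial.idealOfVars s R ^ n) :
    MvPolynomial.aeval a p ∈ RingHom.ker (constantCoeff (σ := σ) (R := R)) ^ n := by
  have h : MvPolynomial.idealOfVars s R ≤
      (RingHom.ker (constantCoeff (σ := σ) (R := R))).comap (MvPolynomial.aeval (R := R) a) := by
    rw [MvPolynomial.idealOfVars, Ideal.span_le]
    rintro _ ⟨i, rfl⟩
    simpa using! ha i
  exact Ideal.le_comap_pow _ n (Ideal.pow_right_mono h n hp)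

variable [Finite σ]

theorem evalₐ_toAdicCompletion (n : ℕ) (f : MvPowerSeries σ R) :
    AdicCompletion.evalₐ (MvPolynomial.idealOfVars σ R) n (toAdicCompletion σ R f) =
      Ideal.Quotient.mk _ (truncTotal n f) :=
  AdicCompletion.evalₐ_liftAlgHom _ (truncTotalAlgHom σ R) (fun h => AlgHom.ext fun _ =>
    Ideal.Quotient.eq.2 (truncTotal_sub_truncTotal_mem_pow_idealOfVars h le_rfl _)) n f

theorem truncTotal_eq_zero_of_le_order {n : ℕ} {f : MvPowerSeries σ R} (hf : (n : ℕ∞) ≤ f.order) :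
    truncTotal n f = 0 := by
  ext d
  by_cases hd : d.degree < n
  · rw [coeff_truncTotal _ hd, MvPolynomial.coeff_zero]
    exact coeff_of_lt_order (lt_of_lt_of_le (by exact_mod_cast hd) hf)
  · rw [coeff_truncTotal_eq_zero _ (not_lt.1 hd), MvPolynomial.coeff_zero]

/-- Evaluation `x_i ↦ a_i` at power series without constant term, modulo terms of degree
at least `n`. -/
def evalLevel (a : s → MvPowerSeries σ R) (ha : ∀ i, constantCoeff (a i) = 0) (n : ℕ) :
    MvPolynomial s R ⧸ MvPolynomial.idealOfVars s R ^ n →+*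
      MvPolynomial σ R ⧸ MvPolynomial.idealOfVars σ R ^ n :=
  Ideal.Quotient.lift _
    ((truncTotalAlgHom σ R n).toRingHom.comp (MvPolynomial.aeval (R := R) a).toRingHom)
    (fun p hp => by
      change Ideal.Quotient.mk _ (truncTotal n (MvPolynomial.aeval a p)) = 0
      rw [truncTotal_eq_zero_of_le_order
        (le_order_of_mem_pow (aeval_mem_ker_constantCoeff_pow ha n hp)), map_zero])

theorem evalLevel_mk {a : s → MvPowerSeries σ R} (ha : ∀ i, constantCoeff (a i) = 0) (n : ℕ)
    (p : MvPolynomial s R) :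
    evalLevel a ha n (Ideal.Quotient.mk _ p) =
      Ideal.Quotient.mk _ (truncTotal n (MvPolynomial.aeval a p)) := rfl

theorem evalLevel_compat {a : s → MvPowerSeries σ R} (ha : ∀ i, constantCoeff (a i) = 0)
    {m n : ℕ} (hle : m ≤ n) :
    (Ideal.Quotient.factorPow (MvPolynomial.idealOfVars σ R) hle).comp ((evalLevel a ha n).comp
        (AdicCompletion.evalₐ (MvPolynomial.idealOfVars s R) n).toRingHom) =
      (evalLevel a ha m).comp
        (AdicCompletion.evalₐ (MvPolynomial.idealOfVars s R) m).toRingHom := by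
  refine RingHom.ext fun x => ?_
  obtain ⟨x, rfl⟩ := AdicCompletion.mk_surjective _ _ x
  have hx := AdicCompletion.Ideal.mk_eq_mk _ hle x
  simp only [RingHom.comp_apply, AlgHom.toRingHom_eq_coe, RingHom.coe_coe,
    AdicCompletion.evalₐ_mk, ← hx, evalLevel_mk]
  exact Ideal.Quotient.eq.2 (truncTotal_sub_truncTotal_mem_pow_idealOfVars hle le_rfl _)

/-- Evaluation `x_i ↦ a_i` of completed polynomials at power series without constant term. -/
def evalHom (a : s → MvPowerSeries σ R) (ha : ∀ i, constantCoeff (a i) = 0) :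
    PowerSeriesRing R s →+* PowerSeriesRing R σ :=
  AdicCompletion.liftRingHom _
    (fun n => (evalLevel a ha n).comp
      (AdicCompletion.evalₐ (MvPolynomial.idealOfVars s R) n).toRingHom)
    (evalLevel_compat ha)

variable {a : s → MvPowerSeries σ R} (ha : ∀ i, constantCoeff (a i) = 0)

theorem evalₐ_evalHom (n : ℕ) (x : PowerSeriesRing R s) :
    AdicCompletion.evalₐ _ n (evalHom a ha x) =
      evalLevel a ha n (AdicCompletion.evalₐ _ n x) :=
  AdicCompletion.evalₐ_liftRingHom _ _ (evalLevel_compat ha) n x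

theorem evalHom_of (p : MvPolynomial s R) :
    evalHom a ha (AdicCompletion.of _ _ p) = toAdicCompletion σ R (MvPolynomial.aeval a p) := by
  apply AdicCompletion.ext_evalₐ
  intro n
  rw [evalₐ_evalHom, AdicCompletion.evalₐ_of, evalLevel_mk, evalₐ_toAdicCompletion]

theorem evalₐ_substVars (F : MvPowerSeries (Fin 2) R) (i j : s) (n : ℕ) :
    AdicCompletion.evalₐ _ n (substVars F i j) =
      Ideal.Quotient.mk _ (MvPolynomial.rename ![i, j] (truncTotal n F)) := by
  rw [substVars, renameVars, evalₐ_adicMap, evalₐ_toAdicCompletion, Ideal.quotientMap_mk]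
  rfl

theorem evalHom_substVars (F : MvPowerSeries (Fin 2) R) (i j : s) :
    evalHom a ha (substVars F i j) = toAdicCompletion σ R (F.subst ![a i, a j]) := by
  apply AdicCompletion.ext_evalₐ
  intro n
  have hpair : ∀ k, constantCoeff (![a i, a j] k) = 0 := by
    intro k
    fin_cases k
    exacts [ha i, ha j]
  rw [evalₐ_evalHom, evalₐ_substVars, evalLevel_mk, evalₐ_toAdicCompletion,
    truncTotal_subst_eq_truncTotal_truncTotal_subst hpair, subst_coe, MvPolynomial.aeval_rename]
  congr 4
  funext k
  fin_cases k <;> rfl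

end Evaluation

/-! ### Generation by the variables of a basis -/

section Density

variable {R σ M : Type*} [CommRing R]

theorem sub_C_mem_idealOfVars {s : Type*} (p : MvPolynomial s R) :
    p - MvPolynomial.C (MvPolynomial.constantCoeff p) ∈ MvPolynomial.idealOfVars s R := by
  rw [← pow_one (MvPolynomial.idealOfVars s R), MvPolynomial.mem_pow_idealOfVars_iff']
  intro d hd
  have : d = 0 := (Finsupp.degree_eq_zero_iff d).1 (Nat.lt_one_iff.1 hd)
  simp [this, MvPolynomial.constantCoeff_eq]

/-- Nakayama's lemma for the augmentation ideal, which is nilpotent modulo `c`. -/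
theorem idealOfVars_le_of_nilpotent (e : σ → M) {c : Ideal (MvPolynomial M R)} {n : ℕ}
    (hc : MvPolynomial.idealOfVars M R ^ n ≤ c)
    (h : MvPolynomial.idealOfVars M R ≤
      Ideal.span (Set.range fun i => MvPolynomial.X (e i)) ⊔
        (c ⊔ MvPolynomial.idealOfVars M R ^ 2)) :
    MvPolynomial.idealOfVars M R ≤
      Ideal.span (Set.range fun i => MvPolynomial.X (e i)) ⊔ c := by
  set L : Ideal (MvPolynomial M R) := Ideal.span (Set.range fun i => MvPolynomial.X (e i)) with hL
  set I := MvPolynomial.idealOfVars M R with hI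
  have key : ∀ k, I ≤ L ⊔ c ⊔ I ^ k := by
    intro k
    induction k with
    | zero => simp
    | succ k ih =>
      have h2 : I ^ 2 ≤ L ⊔ c ⊔ I ^ (k + 1) := by
        rw [pow_two]
        refine (Ideal.mul_mono_right ih).trans ?_
        rw [Ideal.mul_sup, ← pow_succ']
        exact sup_le_sup_right Ideal.mul_le_right _
      refine h.trans (sup_le ?_ (sup_le ?_ h2))
      · exact le_sup_left.trans le_sup_left
      · exact le_sup_right.trans le_sup_left
  exact (key n).trans (sup_le le_rfl (hc.trans le_sup_right))

variable [AddCommGroup M]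

/-- If `μ ↦ x_μ` is additive modulo an ideal `c` and products of two variables, then the
augmentation ideal is generated modulo `c` and these products by the variables of a basis. -/
theorem idealOfVars_le_of_additive (e : Module.Basis σ ℤ M) {c : Ideal (MvPolynomial M R)}
    (hadd : ∀ μ ν : M, (MvPolynomial.X (μ + ν) - MvPolynomial.X μ - MvPolynomial.X ν :
      MvPolynomial M R) ∈ c ⊔ MvPolynomial.idealOfVars M R ^ 2) :
    MvPolynomial.idealOfVars M R ≤
      Ideal.span (Set.range fun i => MvPolynomial.X (e i)) ⊔
        (c ⊔ MvPolynomial.idealOfVars M R ^ 2) := by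
  set L : Ideal (MvPolynomial M R) := Ideal.span (Set.range fun i => MvPolynomial.X (e i)) with hL
  set J := L ⊔ (c ⊔ MvPolynomial.idealOfVars M R ^ 2) with hJ
  let f : M →+ MvPolynomial M R ⧸ J :=
    AddMonoidHom.mk' (fun μ => Ideal.Quotient.mk J (MvPolynomial.X μ)) (fun μ ν => by
      rw [← map_add, Ideal.Quotient.eq, ← sub_sub]
      exact (le_sup_right : _ ≤ J) (hadd μ ν))
  have hf : f.toIntLinearMap = 0 := by
    apply e.ext
    intro i
    exact Ideal.Quotient.eq_zero_iff_mem.2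
      ((le_sup_left : L ≤ J) (Ideal.subset_span ⟨i, rfl⟩))
  rw [MvPolynomial.idealOfVars, Ideal.span_le]
  rintro _ ⟨μ, rfl⟩
  exact Ideal.Quotient.eq_zero_iff_mem.1 (LinearMap.congr_fun hf μ)

/-- A polynomial ring in the `x_μ` is generated, modulo an ideal `c` as below, by the variables
of a basis. -/
theorem exists_sub_rename_mem [Finite σ] (e : Module.Basis σ ℤ M) {c : Ideal (MvPolynomial M R)} {n : ℕ}
    (hc : MvPolynomial.idealOfVars M R ^ n ≤ c)
    (hadd : ∀ μ ν : M, (MvPolynomial.X (μ + ν) - MvPolynomial.X μ - MvPolynomial.X ν :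
      MvPolynomial M R) ∈ c ⊔ MvPolynomial.idealOfVars M R ^ 2) (p : MvPolynomial M R) :
    ∃ q : MvPolynomial σ R, p - MvPolynomial.rename e q ∈ c := by
  have hI := idealOfVars_le_of_nilpotent e hc (idealOfVars_le_of_additive e hadd)
  have key : ∀ k, ∀ p : MvPolynomial M R, ∃ q : MvPolynomial σ R,
      p - MvPolynomial.rename e q ∈ c ⊔ MvPolynomial.idealOfVars M R ^ k := by
    intro k
    induction k with
    | zero => intro p; exact ⟨0, by simp⟩
    | succ k ih =>
      intro p
      obtain ⟨x, hx, y, hy, hxy⟩ := Submodule.mem_sup.1 (hI (sub_C_mem_idealOfVars p))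
      -- `p = p(0) + y + Σ g_i x_{e_i}` with `y ∈ c`, and each `g_i` is known one degree lower.
      cases nonempty_fintype σ
      obtain ⟨g, rfl⟩ := Submodule.mem_span_range_iff_exists_fun _ |>.1 hx
      choose q hq using fun i => ih (g i)
      refine ⟨MvPolynomial.C (MvPolynomial.constantCoeff p) + ∑ i, MvPolynomial.X i * q i, ?_⟩
      have hp : p - MvPolynomial.rename e (MvPolynomial.C (MvPolynomial.constantCoeff p) +
            ∑ i, MvPolynomial.X i * q i) =
          y + ∑ i, MvPolynomial.X (e i) * (g i - MvPolynomial.rename e (q i)) := by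
        simp only [map_add, map_sum, map_mul, MvPolynomial.rename_C, MvPolynomial.rename_X,
          mul_sub, Finset.sum_sub_distrib]
        simp only [smul_eq_mul, mul_comm (g _)] at hxy
        linear_combination -hxy
      rw [hp]
      refine add_mem (Ideal.mem_sup_left hy) (sum_mem fun i _ => ?_)
      have hm := Ideal.mul_mem_mul
        (Ideal.subset_span ⟨e i, rfl⟩ : MvPolynomial.X (e i) ∈ MvPolynomial.idealOfVars M R) (hq i)
      rw [Ideal.mul_sup, ← pow_succ'] at hm
      have hle : MvPolynomial.idealOfVars M R * c ⊔ MvPolynomial.idealOfVars M R ^ (k + 1) ≤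
          c ⊔ MvPolynomial.idealOfVars M R ^ (k + 1) := sup_le_sup_right Ideal.mul_le_right _
      exact hle hm
  obtain ⟨q, hq⟩ := key n p
  exact ⟨q, sup_le le_rfl hc hq⟩

end Density

/-! ### The formal group algebra embeds in a power series ring -/

section FormalEmbedding

open MvPowerSeries

variable {R σ M : Type*} [CommRing R]

theorem of_mem_ker_evalₐ {n : ℕ} {p : MvPolynomial M R}
    (hp : p ∈ MvPolynomial.idealOfVars M R ^ n) :
    (AdicCompletion.of _ _ p : PowerSeriesRing R M) ∈
      RingHom.ker (AdicCompletion.evalₐ (MvPolynomial.idealOfVars M R) n) := by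
  rw [RingHom.mem_ker, AdicCompletion.evalₐ_of]
  exact Ideal.Quotient.eq_zero_iff_mem.2 hp

variable [AddCommGroup M]

/-- The polynomials that vanish in the formal group algebra up to terms of degree at
least `n`. -/
def relationsUpTo (F : FormalGroup R) (M : Type*) [AddCommGroup M] (n : ℕ) :
    Ideal (MvPolynomial M R) :=
  (formalRelations F M ⊔
    RingHom.ker (AdicCompletion.evalₐ (MvPolynomial.idealOfVars M R) n)).comap
    (algebraMap (MvPolynomial M R) (PowerSeriesRing R M))

theorem pow_le_relationsUpTo (F : FormalGroup R) (n : ℕ) :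
    MvPolynomial.idealOfVars M R ^ n ≤ relationsUpTo F M n :=
  fun _ hp => Ideal.mem_sup_right (of_mem_ker_evalₐ hp)

theorem X_add_sub_mem (F : FormalGroup R) (n : ℕ) (μ ν : M) :
    (MvPolynomial.X (μ + ν) - MvPolynomial.X μ - MvPolynomial.X ν : MvPolynomial M R) ∈
      relationsUpTo F M n ⊔ MvPolynomial.idealOfVars M R ^ 2 := by
  set T := truncTotal (n + 2) F.toPowerSeries with hT
  have h1 : MvPolynomial.X (μ + ν) - MvPolynomial.rename ![μ, ν] T ∈ relationsUpTo F M n := by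
    rw [relationsUpTo, Ideal.mem_comap, map_sub, ← sub_add_sub_cancel _
      (substVars F.toPowerSeries μ ν)]
    refine add_mem (Ideal.mem_sup_left (Ideal.subset_span (Or.inr ⟨(μ, ν), rfl⟩)))
      (Ideal.mem_sup_right ?_)
    rw [RingHom.mem_ker, map_sub, evalₐ_substVars, AdicCompletion.algebraMap_apply,
      AdicCompletion.evalₐ_of, Algebra.algebraMap_self_apply, ← map_sub, ← map_sub]
    apply Ideal.Quotient.eq_zero_iff_mem.2
    exact Ideal.le_comap_pow _ n (Ideal.pow_right_mono (idealOfVars_le_comap_rename ![μ, ν]) n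
      (truncTotal_sub_truncTotal_mem_pow_idealOfVars le_rfl (by lia) _))
  have h2 : T - MvPolynomial.X 0 - MvPolynomial.X 1 ∈ MvPolynomial.idealOfVars (Fin 2) R ^ 2 := by
    obtain ⟨G, hG, hG1⟩ := exists_toPowerSeries_eq F
    rw [MvPolynomial.mem_pow_idealOfVars_iff']
    intro d hd
    rw [MvPolynomial.coeff_sub, MvPolynomial.coeff_sub, hT,
      coeff_truncTotal _ (lt_of_lt_of_le hd (by lia)), ← MvPolynomial.coeff_coe,
      ← MvPolynomial.coeff_coe, MvPolynomial.coe_X, MvPolynomial.coe_X, ← map_sub, ← map_sub, hG]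
    have hf : (X 0 + X 1 * G - X 0 - X 1 : MvPowerSeries (Fin 2) R) = X 1 * (G - 1) := by ring
    rw [hf]
    apply coeff_of_lt_order
    refine lt_of_lt_of_le (b := (2 : ℕ∞)) (by exact_mod_cast hd) ?_
    rw [← one_add_one_eq_two]
    exact (add_le_add (one_le_order (by simp)) (one_le_order (by simp [hG1]))).trans le_order_mul
  have h3 : MvPolynomial.rename ![μ, ν] (T - MvPolynomial.X 0 - MvPolynomial.X 1) ∈
      MvPolynomial.idealOfVars M R ^ 2 :=
    Ideal.le_comap_pow _ 2 (Ideal.pow_right_mono (idealOfVars_le_comap_rename ![μ, ν]) 2 h2)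
  rw [map_sub, map_sub, MvPolynomial.rename_X, MvPolynomial.rename_X] at h3
  convert Submodule.add_mem_sup h1 h3 using 1
  simp only [Matrix.cons_val_zero, Matrix.cons_val_one, Matrix.cons_val_fin_one]
  ring

theorem exists_sub_of_rename_mem [Finite σ] (F : FormalGroup R) (e : Module.Basis σ ℤ M) (n : ℕ)
    (x : PowerSeriesRing R M) :
    ∃ q : MvPolynomial σ R, x - AdicCompletion.of _ _ (MvPolynomial.rename e q) ∈
      formalRelations F M ⊔
        RingHom.ker (AdicCompletion.evalₐ (MvPolynomial.idealOfVars M R) n) := by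
  obtain ⟨p, hp⟩ := Ideal.Quotient.mk_surjective (AdicCompletion.evalₐ _ n x)
  obtain ⟨q, hq⟩ := exists_sub_rename_mem e (pow_le_relationsUpTo F n) (X_add_sub_mem F n) p
  refine ⟨q, ?_⟩
  rw [← sub_add_sub_cancel _ (AdicCompletion.of _ _ p), ← map_sub (AdicCompletion.of _ _) p]
  refine add_mem (Ideal.mem_sup_right ?_) hq
  rw [RingHom.mem_ker, map_sub, AdicCompletion.evalₐ_of, hp, sub_self]

variable [IsDomain R] [Finite σ] (F : FormalGroup R) [F.IsComm] (e : Module.Basis σ ℤ M)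

/-- Evaluation of completed polynomials at the points `x_μ ↦ [μ]` of the formal group. -/
def latticeEval : PowerSeriesRing R M →+* PowerSeriesRing R σ :=
  evalHom (fun μ => (latticePoint F e μ).val) (fun _ => point_constantCoeff _)

theorem latticeEval_X (μ : M) :
    latticeEval F e (AdicCompletion.of _ _ (MvPolynomial.X μ)) =
      toAdicCompletion σ R (latticePoint F e μ).val := by
  rw [latticeEval, evalHom_of, MvPolynomial.aeval_X]

theorem formalRelations_le_ker : formalRelations F M ≤ RingHom.ker (latticeEval F e) := by
  rw [formalRelations, Ideal.span_le]
  rintro _ (rfl | ⟨⟨μ, ν⟩, rfl⟩)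
  · rw [SetLike.mem_coe, RingHom.mem_ker, latticeEval_X, map_zero, FormalGroup.zero_apply,
      map_zero]
  · rw [SetLike.mem_coe, RingHom.mem_ker, map_sub, latticeEval_X, map_add,
      FormalGroup.add_apply, latticeEval, evalHom_substVars, sub_self]

theorem evalₐ_latticeEval_eq_zero {n : ℕ} {x : PowerSeriesRing R M}
    (hx : x ∈ formalRelations F M ⊔
      RingHom.ker (AdicCompletion.evalₐ (MvPolynomial.idealOfVars M R) n)) :
    AdicCompletion.evalₐ _ n (latticeEval F e x) = 0 := by
  obtain ⟨y, hy, z, hz, rfl⟩ := Submodule.mem_sup.1 hx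
  have hy' : latticeEval F e y = 0 := formalRelations_le_ker F e hy
  rw [map_add, hy', zero_add, latticeEval, evalₐ_evalHom, (RingHom.mem_ker.1 hz), map_zero]

/-- The kernel of `x_μ ↦ [μ]` is the closure of the formal group relations. Modulo the relations
and terms of degree at least `n`, every element is a polynomial in the variables of the basis;
these go to the independent variables `t_i`, so such a polynomial has order at least `n` when its
image does. -/
theorem ker_latticeEval : RingHom.ker (latticeEval F e) = closureIdeal (formalRelations F M) := by
  ext x
  simp only [closureIdeal, Submodule.mem_iInf]
  constructor
  · intro hx n
    obtain ⟨q, hq⟩ := exists_sub_of_rename_mem F e n x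
    have hq' := evalₐ_latticeEval_eq_zero F e hq
    have hcomp : (fun μ => (latticePoint F e μ).val) ∘ e = X := by
      funext i
      exact latticePoint_basis e i
    have he : MvPolynomial.aeval (fun μ => (latticePoint F e μ).val) (MvPolynomial.rename e q) =
        (q : MvPowerSeries σ R) := by
      rw [MvPolynomial.aeval_rename, hcomp, ← subst_coe, subst_self, id]
    rw [map_sub, RingHom.mem_ker.1 hx, zero_sub, map_neg, neg_eq_zero, latticeEval, evalHom_of, he,
      toAdicCompletion_coe, AdicCompletion.evalₐ_of, Ideal.Quotient.eq_zero_iff_mem] at hq'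
    rw [← sub_add_cancel x (AdicCompletion.of _ _ (MvPolynomial.rename e q))]
    exact add_mem hq (Ideal.mem_sup_right (of_mem_ker_evalₐ
      (Ideal.le_comap_pow _ n (Ideal.pow_right_mono (idealOfVars_le_comap_rename e) n hq'))))
  · intro hx
    rw [RingHom.mem_ker]
    apply AdicCompletion.ext_evalₐ
    intro n
    rw [evalₐ_latticeEval_eq_zero F e (hx n), map_zero]

/-- The embedding of the formal group algebra into a ring of power series. -/
def formalEmbedding : FormalGroupAlgebra F M →+* MvPowerSeries σ R :=
  ((toAdicCompletionAlgEquiv σ R).symm.toRingEquiv.toRingHom).comp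
    (Ideal.Quotient.lift _ (latticeEval F e) fun x hx => by rwa [← ker_latticeEval F e] at hx)

theorem formalEmbedding_injective : Function.Injective (formalEmbedding F e) := by
  refine (toAdicCompletionAlgEquiv σ R).symm.injective.comp ?_
  exact RingHom.lift_injective_of_ker_le_ideal _ _ (ker_latticeEval F e).le

theorem formalEmbedding_X (μ : M) :
    formalEmbedding F e (Ideal.Quotient.mk _ (AdicCompletion.of _ _ (MvPolynomial.X μ))) =
      (latticePoint F e μ).val := by
  change (toAdicCompletionAlgEquiv σ R).symm (latticeEval F e _) = _
  rw [latticeEval_X, ← toAdicCompletionAlgEquiv_apply, AlgEquiv.symm_apply_apply]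

end FormalEmbedding

/-! ### The connective algebra embeds in a power series ring -/

section ConnectiveEmbedding

open MvPowerSeries

variable {R σ M : Type*} [CommRing R] [AddCommGroup M] (c : R)

theorem connective_X_zero :
    Ideal.Quotient.mk (connectiveRelations c M) (MvPolynomial.X 0) = 0 :=
  Ideal.Quotient.eq_zero_iff_mem.2 (Ideal.subset_span (Or.inl rfl))

theorem connective_X_add (μ ν : M) :
    Ideal.Quotient.mk (connectiveRelations c M) (MvPolynomial.X (μ + ν)) =
      Ideal.Quotient.mk _ (MvPolynomial.X μ) + Ideal.Quotient.mk _ (MvPolynomial.X ν) -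
        Ideal.Quotient.mk _ (MvPolynomial.C c) * Ideal.Quotient.mk _ (MvPolynomial.X μ) *
          Ideal.Quotient.mk _ (MvPolynomial.X ν) := by
  rw [← map_mul, ← map_mul, ← map_add, ← map_sub]
  exact Ideal.Quotient.eq.2 (Ideal.subset_span (Or.inr ⟨(μ, ν), rfl⟩))

theorem connective_X_add_X_neg (μ : M) :
    Ideal.Quotient.mk (connectiveRelations c M) (MvPolynomial.X μ) +
      Ideal.Quotient.mk _ (MvPolynomial.X (-μ)) -
        Ideal.Quotient.mk _ (MvPolynomial.C c) * Ideal.Quotient.mk _ (MvPolynomial.X μ) *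
          Ideal.Quotient.mk _ (MvPolynomial.X (-μ)) = 0 := by
  rw [← connective_X_add, add_neg_cancel, connective_X_zero]

theorem isUnit_one_sub_connective_X (μ : M) :
    IsUnit (1 - Ideal.Quotient.mk (connectiveRelations c M) (MvPolynomial.C c) *
      Ideal.Quotient.mk _ (MvPolynomial.X μ)) :=
  IsUnit.of_mul_eq_one (1 - Ideal.Quotient.mk (connectiveRelations c M) (MvPolynomial.C c) *
    Ideal.Quotient.mk _ (MvPolynomial.X (-μ))) (by
      linear_combination -Ideal.Quotient.mk (connectiveRelations c M) (MvPolynomial.C c) *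
        connective_X_add_X_neg c μ)

/-- A polynomial in the variables of a basis, as an element of the connective algebra. -/
def basisPolynomial (e : Module.Basis σ ℤ M) : MvPolynomial σ R →+* ConnectiveAlgebra c M :=
  (Ideal.Quotient.mk _).comp (MvPolynomial.rename e : _ →ₐ[R] _).toRingHom

/-- The elements of the connective algebra that are fractions of polynomials in the variables of
a basis. -/
def basisFractions (e : Module.Basis σ ℤ M) : Subring (ConnectiveAlgebra c M) where
  carrier := {s | ∃ v q, IsUnit (basisPolynomial c e v) ∧
    s * basisPolynomial c e v = basisPolynomial c e q}
  zero_mem' := ⟨1, 0, by simp, by simp⟩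
  one_mem' := ⟨1, 1, by simp, by simp⟩
  add_mem' := by
    rintro a b ⟨v, q, hv, hq⟩ ⟨v', q', hv', hq'⟩
    refine ⟨v * v', q * v' + q' * v, by rw [map_mul]; exact hv.mul hv', ?_⟩
    simp only [map_add, map_mul, ← hq, ← hq']
    ring
  mul_mem' := by
    rintro a b ⟨v, q, hv, hq⟩ ⟨v', q', hv', hq'⟩
    refine ⟨v * v', q * q', by rw [map_mul]; exact hv.mul hv', ?_⟩
    simp only [map_mul, ← hq, ← hq']
    ring
  neg_mem' := by
    rintro a ⟨v, q, hv, hq⟩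
    exact ⟨v, -q, hv, by rw [map_neg, ← hq]; exact neg_mul a _⟩

theorem C_mem_basisFractions (e : Module.Basis σ ℤ M) (r : R) :
    Ideal.Quotient.mk _ (MvPolynomial.C r) ∈ basisFractions c e :=
  ⟨1, MvPolynomial.C r, by simp, by simp [basisPolynomial]⟩

theorem X_mem_basisFractions (e : Module.Basis σ ℤ M) (μ : M) :
    Ideal.Quotient.mk _ (MvPolynomial.X μ) ∈ basisFractions c e := by
  have hμ : μ ∈ Submodule.span ℤ (Set.range e) := by rw [e.span_eq]; trivial
  rw [← Submodule.mem_toAddSubgroup, Submodule.span_int_eq_addSubgroupClosure] at hμ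
  induction hμ using AddSubgroup.closure_induction with
  | mem μ hμ =>
    obtain ⟨i, rfl⟩ := hμ
    exact ⟨1, MvPolynomial.X i, by simp, by simp [basisPolynomial]⟩
  | zero => rw [connective_X_zero]; exact zero_mem _
  | add μ ν _ _ hμ hν =>
    rw [connective_X_add]
    exact sub_mem (add_mem hμ hν) (mul_mem (mul_mem (C_mem_basisFractions c e c) hμ) hν)
  | neg μ _ hμ =>
    -- `x_{-μ} = -x_μ / (1 - c x_μ)`
    obtain ⟨v, q, hv, hq⟩ := hμ
    have hC : basisPolynomial c e (MvPolynomial.C c) =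
        Ideal.Quotient.mk _ (MvPolynomial.C c) := by simp [basisPolynomial]
    have hd : basisPolynomial c e (v - MvPolynomial.C c * q) =
        (1 - Ideal.Quotient.mk _ (MvPolynomial.C c) * Ideal.Quotient.mk _ (MvPolynomial.X μ)) *
          basisPolynomial c e v := by
      rw [map_sub, map_mul, hC, ← hq]
      ring
    refine ⟨v - MvPolynomial.C c * q, -q, ?_, ?_⟩
    · rw [hd]
      exact (isUnit_one_sub_connective_X c μ).mul hv
    · rw [hd, map_neg, ← hq]
      linear_combination basisPolynomial c e v * connective_X_add_X_neg c μ

theorem mem_basisFractions (e : Module.Basis σ ℤ M) (s : ConnectiveAlgebra c M) :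
    s ∈ basisFractions c e := by
  obtain ⟨p, rfl⟩ := Ideal.Quotient.mk_surjective s
  induction p using MvPolynomial.induction_on with
  | C r => exact C_mem_basisFractions c e r
  | add p q hp hq => rw [map_add]; exact add_mem hp hq
  | mul_X p μ hp => rw [map_mul]; exact mul_mem hp (X_mem_basisFractions c e μ)

variable [IsDomain R] [Finite σ] (e : Module.Basis σ ℤ M)

/-- The embedding of the connective algebra into a ring of power series. -/
def connectiveEmbedding : ConnectiveAlgebra c M →+* MvPowerSeries σ R :=
  Ideal.Quotient.lift _
    (MvPolynomial.aeval (R := R)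
      fun μ => (latticePoint (connectiveFormalGroup c) e μ).val).toRingHom (by
    intro p hp
    rw [← RingHom.mem_ker]
    revert p
    change connectiveRelations c M ≤ _
    rw [connectiveRelations, Ideal.span_le]
    rintro _ (rfl | ⟨⟨μ, ν⟩, rfl⟩)
    · simp [RingHom.mem_ker]
    · simp only [SetLike.mem_coe, RingHom.mem_ker, AlgHom.toRingHom_eq_coe, RingHom.coe_coe,
        map_sub, map_add, map_mul, MvPolynomial.aeval_X, MvPolynomial.aeval_C,
        MvPowerSeries.algebraMap_apply, Algebra.algebraMap_self, RingHom.id_apply]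
      exact sub_eq_zero.2
        (connectiveFormalGroup_subst c (point_constantCoeff _) (point_constantCoeff _)))

theorem connectiveEmbedding_X (μ : M) :
    connectiveEmbedding c e (Ideal.Quotient.mk _ (MvPolynomial.X μ)) =
      (latticePoint (connectiveFormalGroup c) e μ).val :=
  MvPolynomial.aeval_X _ _

theorem connectiveEmbedding_basisPolynomial (q : MvPolynomial σ R) :
    connectiveEmbedding c e (basisPolynomial c e q) = q := by
  have hcomp : (fun μ => (latticePoint (connectiveFormalGroup c) e μ).val) ∘ e = X := by
    funext i
    exact latticePoint_basis e i
  change MvPolynomial.aeval (fun μ => (latticePoint (connectiveFormalGroup c) e μ).val)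
    (MvPolynomial.rename e q) = _
  rw [MvPolynomial.aeval_rename, hcomp, ← subst_coe, subst_self, id]

theorem connectiveEmbedding_injective : Function.Injective (connectiveEmbedding c e) := by
  rw [injective_iff_map_eq_zero]
  intro s hs
  obtain ⟨v, q, hv, hq⟩ := mem_basisFractions c e s
  have h := congrArg (connectiveEmbedding c e) hq
  rw [map_mul, hs, zero_mul, connectiveEmbedding_basisPolynomial, eq_comm,
    MvPolynomial.coe_eq_zero_iff] at h
  rwa [h, map_zero, hv.mul_left_eq_zero] at hq

end ConnectiveEmbedding

/-! ### Faithfulness of the Weyl group action and divisibility -/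

section Hypotheses

variable {ι M N : Type*} [AddCommGroup M] [AddCommGroup N] {P : RootPairing ι ℤ M N}

/-- The character lattice of a simply connected root datum is free of finite rank. -/
theorem finite_free_of_isSimplyConnected [Finite ι] (hsc : IsSimplyConnected P) :
    Module.Finite ℤ M ∧ Module.Free ℤ M := by
  have : Module.Finite ℤ N :=
    ⟨by rw [← hsc, RootPairing.corootSpan]; exact Submodule.fg_span (Set.finite_range _)⟩
  have : Module.IsReflexive ℤ N := .of_isPerfPair P.flip.toLinearMap
  exact ⟨Module.Finite.equiv P.toLinearMap.toPerfPair.symm,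
    Module.Free.of_equiv P.toLinearMap.toPerfPair.symm⟩

theorem EquivariantRing.exists_act_sub_mem_nonZeroDivisors {S A : Type*} [CommRing S] [CommRing A]
    [NoZeroDivisors A] (E : EquivariantRing P S) (φ : S →+* A) (hφ : Function.Injective φ)
    (hx : Function.Injective fun μ => φ (E.x μ)) (w : P.weylGroup) (hw : w ≠ 1) :
    ∃ s, E.act w s - s ∈ nonZeroDivisors S := by
  have : NoZeroDivisors S := hφ.noZeroDivisors φ (map_zero φ) (map_mul φ)
  obtain ⟨μ, hμ⟩ : ∃ μ : M, w • μ ≠ μ := by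
    by_contra! h
    exact hw (weylGroup_eq_one_of_smul_eq h)
  refine ⟨E.x μ, mem_nonZeroDivisors_of_ne_zero (sub_ne_zero.2 fun h => hμ (hx ?_))⟩
  rw [E.act_x] at h
  exact congrArg φ h

theorem connectiveRing_x_neg_dvd {R : Type*} [CommRing R] (c : R) (μ : M) :
    (connectiveRing P c).x (-μ) ∣ (connectiveRing P c).x μ := by
  refine ⟨-(1 - Ideal.Quotient.mk _ (MvPolynomial.C c) *
    Ideal.Quotient.mk _ (MvPolynomial.X μ)), ?_⟩
  change Ideal.Quotient.mk (connectiveRelations c M) (MvPolynomial.X μ) =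
    Ideal.Quotient.mk _ (MvPolynomial.X (-μ)) * _
  linear_combination connective_X_add_X_neg c μ

/-- Since `F(x, y) = x + y G(x, y)`, the relation `F(x_μ, x_{-μ}) = 0` shows that `x_{-μ}`
divides `x_μ`. -/
theorem formalRing_x_neg_dvd {R : Type*} [CommRing R] (F : FormalGroup R) (μ : M) :
    (formalRing P F).x (-μ) ∣ (formalRing P F).x μ := by
  obtain ⟨G, hG, -⟩ := exists_toPowerSeries_eq F
  have hle : formalRelations F M ≤ closureIdeal (formalRelations F M) :=
    le_iInf fun _ => le_sup_left
  have h0 : Ideal.Quotient.mk (closureIdeal (formalRelations F M))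
      (AdicCompletion.of _ _ (MvPolynomial.X 0)) = 0 :=
    Ideal.Quotient.eq_zero_iff_mem.2 (hle (Ideal.subset_span (Or.inl rfl)))
  have h1 : Ideal.Quotient.mk (closureIdeal (formalRelations F M))
      (AdicCompletion.of _ _ (MvPolynomial.X (μ + -μ))) =
        Ideal.Quotient.mk _ (substVars F.toPowerSeries μ (-μ)) :=
    Ideal.Quotient.eq.2 (hle (Ideal.subset_span (Or.inr ⟨(μ, -μ), rfl⟩)))
  have h2 : substVars F.toPowerSeries μ (-μ) = AdicCompletion.of _ _ (MvPolynomial.X μ) +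
      AdicCompletion.of _ _ (MvPolynomial.X (-μ)) * substVars G μ (-μ) := by
    rw [hG, substVars, substVars, map_add, map_mul, map_add, map_mul, ← MvPolynomial.coe_X,
      ← MvPolynomial.coe_X, MvPowerSeries.toAdicCompletion_coe,
      MvPowerSeries.toAdicCompletion_coe, renameVars_of, renameVars_of, MvPolynomial.rename_X,
      MvPolynomial.rename_X]
    rfl
  rw [add_neg_cancel, h0, h2, map_add, map_mul] at h1
  refine ⟨-Ideal.Quotient.mk _ (substVars G μ (-μ)), ?_⟩
  change Ideal.Quotient.mk (closureIdeal (formalRelations F M)) (AdicCompletion.of _ _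
    (MvPolynomial.X μ)) = Ideal.Quotient.mk _ (AdicCompletion.of _ _ (MvPolynomial.X (-μ))) * _
  linear_combination -h1

end Hypotheses

end Peterson

end

theorem theorem5 {ι M N R : Type*} [AddCommGroup M] [AddCommGroup N]
    [CommRing R] [IsDomain R] [CharZero R]
    (P : RootPairing ι ℤ M N) [Finite ι] [P.IsReduced]
    (hirr : Peterson.IsIrreducibleRootDatum P) (hsc : Peterson.IsSimplyConnected P)
    (b : P.Base) (θ : ι) (hθ : Peterson.IsHighestRoot b θ) :
    (∀ (F : FormalGroup R) [F.IsComm],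
      (Peterson.formalRing P F).centralizerS b θ =
          Set.range (Peterson.formalRing P F).k ∩ ((Peterson.formalRing P F).fada b θ) ∧
        Set.range (Peterson.formalRing P F).k ∩ ((Peterson.formalRing P F).fada b θ) =
          (Peterson.formalRing P F).k '' ((Peterson.formalRing P F).fadaModW b θ) ∧
        (Peterson.formalRing P F).petersonSubalgebra b θ =
          (Peterson.formalRing P F).centralizerS b θ) ∧
    (∀ c : R,
      (Peterson.connectiveRing P c).centralizerS b θ =
          Set.range (Peterson.connectiveRing P c).k ∩ ((Peterson.connectiveRing P c).fada b θ) ∧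
        Set.range (Peterson.connectiveRing P c).k ∩ ((Peterson.connectiveRing P c).fada b θ) =
          (Peterson.connectiveRing P c).k '' ((Peterson.connectiveRing P c).fadaModW b θ) ∧
        (Peterson.connectiveRing P c).petersonSubalgebra b θ =
          (Peterson.connectiveRing P c).centralizerS b θ) := by
  obtain ⟨_, _⟩ := Peterson.finite_free_of_isSimplyConnected hsc
  let e := Module.Free.chooseBasis ℤ M
  refine ⟨fun F _ => ?_, fun c => ?_⟩
  · refine Peterson.EquivariantRing.centralizerS_eq _ b θ (Peterson.formalRing_x_neg_dvd F)
      (Peterson.EquivariantRing.exists_act_sub_mem_nonZeroDivisors _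
        (Peterson.formalEmbedding F e) (Peterson.formalEmbedding_injective F e) ?_)
    intro μ ν h
    apply Peterson.latticePoint_injective (F := F) e
    apply Subtype.ext
    rw [← Peterson.formalEmbedding_X, ← Peterson.formalEmbedding_X]
    exact h
  · refine Peterson.EquivariantRing.centralizerS_eq _ b θ (Peterson.connectiveRing_x_neg_dvd c)
      (Peterson.EquivariantRing.exists_act_sub_mem_nonZeroDivisors _
        (Peterson.connectiveEmbedding c e) (Peterson.connectiveEmbedding_injective c e) ?_)
    intro μ ν h
    apply Peterson.latticePoint_injective (F := Peterson.connectiveFormalGroup c) e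
    apply Subtype.ext
    rw [← Peterson.connectiveEmbedding_X, ← Peterson.connectiveEmbedding_X]
    exact h
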